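/- Let $K$ be a perfect field of characteristic $2$ and let $G=\mathsf G_2(K)$ be the split group of type $\mathsf G_2$ over $K$, i.e. the automorphism group of the split octonion algebra over $K$, acting on $\mathrm{PG}(5,K)$ through its $6$-dimensional representation on trace-zero octonions modulo $K\cdot 1$. This action preserves the symplectic form $\langle x,y\rangle$ induced by the octonion norm and the set of hexagon lines, that is, the lines of the split Cayley hexagon on the quadric $X_0X_4+X_1X_5+X_2X_6=X_3^2$ of $\mathrm{PG}(6,K)$ projected from $(0,0,0,1,0,0,0)$ onto $\mathrm{PG}(5,K)=\{X_3=0\}$. Let $\Gamma_2$ be the rank $3$ geometry whose points are all points of $\mathrm{PG}(5,K)$, whose lines are the lines of $\mathrm{PG}(5,K)$ that are not totally isotropic, and whose planes are the planes of $\mathrm{PG}(5,K)$ that are not totally isotropic and contain a hexagon line. Incidence of points and lines, and of lines and planes, is containment; a point and a plane are incident if some line of $\Gamma_2$ is incident with both. Let $p,l,\pi_1$ be a chamber (a triple of pairwise incident point, line and plane) of $\Gamma_2$, let $g\in G_l$, and put $\pi_2=g\pi_1$. Suppose that the chambers $p,l,\pi_1$ and $p,l,\pi_2$ represent different orbits of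 $G$ on the chambers of $\Gamma_2$; that is, $\pi_1$ and $\pi_2$ lie in different orbits of $G_{p,l}$. Then $G$ is the universal enveloping group of the fused amalgam consisting of the stabilisers $G_p$, $G_l$, $G_{\pi_1}$, $G_{\pi_2}$, $G_{p,l}$, $G_{p,\pi_1}$, $G_{p,\pi_2}$, $G_{l,\pi_1}$, $G_{l,\pi_2}$, $G_{p,l,\pi_1}$, $G_{p,l,\pi_2}$ with their inclusions, in which $G_{\pi_1}$ is fused with $G_{\pi_2}$ by $\gamma(x)=gxg^{-1}$. Explicitly, let $\mathcal U$ be the group with one generator $u_x$ for every element $x$ of the disjoint union of these eleven groups and the following relations: $u_xu_y=u_{xy}$ for $x,y$ in the same group; $u_x=u_y$ whenever an inclusion of the amalgam maps $x$ to $y$; and $u_{\gamma(x)}=u_g\,u_x\,u_g^{-1}$ for $x\in G_{\pi_1}$, where $u_g$ is the generator of $g\in G_l$ and $u_{\gamma(x)}$ that of $\gamma(x)\in G_{\pi_2}$. Then there is an isomorphism $\mathcal U\to G$ that sends every $u_x$ to $x$. -/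

import Mathlib

/-! ## Split octonions and the group `G₂(K)` -/

/-- The underlying vector space of the split octonion algebra over `K`, in Zorn's vector matrix
form: `(a, b, u, v)` stands for the matrix with diagonal entries `a`, `b` in `K` and off-diagonal
entries `u` (top right), `v` (bottom left) in `K ^ 3`. -/
abbrev SplitOctonion (K : Type*) : Type _ := K × K × (Fin 3 → K) × (Fin 3 → K)

/-- Zorn's multiplication of vector matrices. -/
def zornMul {K : Type*} [Field K] (x y : SplitOctonion K) : SplitOctonion K :=
  (x.1 * y.1 + x.2.2.1 ⬝ᵥ y.2.2.2,
   x.2.1 * y.2.1 + x.2.2.2 ⬝ᵥ y.2.2.1,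
   x.1 • y.2.2.1 + y.2.1 • x.2.2.1 - crossProduct x.2.2.2 y.2.2.2,
   y.1 • x.2.2.2 + x.2.1 • y.2.2.2 + crossProduct x.2.2.1 y.2.2.1)

/-- The automorphism group of the split octonion algebra over `K`. -/
def octonionAut (K : Type*) [Field K] : Subgroup (SplitOctonion K ≃ₗ[K] SplitOctonion K) where
  carrier := {g | ∀ x y, g (zornMul x y) = zornMul (g x) (g y)}
  one_mem' := fun _ _ => rfl
  mul_mem' := by
    intro g h hg hh x y
    change g (h _) = zornMul (g (h x)) (g (h y))
    rw [hh, hg]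
  inv_mem' := by
    intro g hg x y
    apply g.injective
    have key : ∀ z, g (g⁻¹ z) = z := fun z => g.apply_symm_apply z
    rw [hg, key, key, key]

/-- The (split, Chevalley) group `G₂(K)`: the automorphism group of the split octonion algebra. -/
abbrev G2 (K : Type*) [Field K] : Type _ := ↥(octonionAut K)

/-! ## The symplectic space and the six-dimensional representation in characteristic two

The trace-zero octonions carry the quadric `Q(6, K)`; in characteristic two they contain the
identity, and dividing by it gives the six-dimensional symplectic space. In coordinates,
`(X₀, X₁, X₂, X₃, X₄, X₅, X₆)` is the trace-zero octonion `(X₃, X₃, (X₀, X₁, X₂), (X₄, X₅, X₆))`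
and dividing by the identity means dropping `X₃`. -/

/-- The six-dimensional space underlying `PG(5, K)`; `(u, v)` has the homogeneous coordinates
`u = (X₀, X₁, X₂)` and `v = (X₄, X₅, X₆)`. -/
abbrev V6 (K : Type*) : Type _ := (Fin 3 → K) × (Fin 3 → K)

/-- The octonion `(0, 0, u, v)`. -/
def inclV6 (K : Type*) [Field K] : V6 K →ₗ[K] SplitOctonion K :=
  (LinearMap.inr K K (K × V6 K)).comp (LinearMap.inr K K (V6 K))

/-- The off-diagonal part of an octonion. -/
def projV6 (K : Type*) [Field K] : SplitOctonion K →ₗ[K] V6 K :=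
  (LinearMap.snd K K (V6 K)).comp (LinearMap.snd K K (K × V6 K))

theorem octonionAut_map_one {K : Type*} [Field K] (g : G2 K) :
    g.1 ((1, 1, 0, 0) : SplitOctonion K) = (1, 1, 0, 0) := by
  obtain ⟨x, hx⟩ := g.1.surjective ((1, 1, 0, 0) : SplitOctonion K)
  have h := g.2 x (1, 1, 0, 0)
  have h1 : zornMul x ((1, 1, 0, 0) : SplitOctonion K) = x := by
    simp [zornMul]
  have h2 : ∀ y : SplitOctonion K, zornMul ((1, 1, 0, 0) : SplitOctonion K) y = y := by
    intro y
    simp [zornMul]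
  rw [h1, hx, h2] at h
  exact h.symm

theorem octonionAut_trace_zero {K : Type*} [Field K] [CharP K 2] (g : G2 K) (w : V6 K) :
    (g.1 (inclV6 K w)).1 = (g.1 (inclV6 K w)).2.1 := by
  have h := g.2 (inclV6 K w) (inclV6 K w)
  have h1 : zornMul (inclV6 K w) (inclV6 K w)
      = (w.1 ⬝ᵥ w.2) • ((1, 1, 0, 0) : SplitOctonion K) := by
    simp [zornMul, inclV6, dotProduct_comm w.2 w.1]
  rw [h1, map_smul, octonionAut_map_one] at h
  have ha := congrArg (fun z : SplitOctonion K => z.1) h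
  have hb := congrArg (fun z : SplitOctonion K => z.2.1) h
  simp only [zornMul, Prod.smul_fst, Prod.smul_snd] at ha hb
  rw [dotProduct_comm (g.1 (inclV6 K w)).2.2.2] at hb
  have h2 : (g.1 (inclV6 K w)).1 ^ 2 = (g.1 (inclV6 K w)).2.1 ^ 2 := by
    linear_combination hb - ha
  exact CharTwo.sq_injective h2

/-- The six-dimensional representation of `G₂(K)` in characteristic two: the action on trace-zero
octonions modulo the identity, in coordinates. -/
def rep6 (K : Type*) [Field K] [CharP K 2] : G2 K →* Module.End K (V6 K) where
  toFun g := (projV6 K).comp ((g.1 : SplitOctonion K →ₗ[K] SplitOctonion K).comp (inclV6 K))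
  map_one' := rfl
  map_mul' := by
    intro g h
    apply LinearMap.ext
    intro w
    have key : h.1 (inclV6 K w) = inclV6 K (projV6 K (h.1 (inclV6 K w)))
        + (h.1 (inclV6 K w)).1 • ((1, 1, 0, 0) : SplitOctonion K) := by
      refine Prod.ext ?_ (Prod.ext ?_ ?_)
      · simp [inclV6]
      · simpa [inclV6] using (octonionAut_trace_zero h w).symm
      · simp [inclV6, projV6]
    change projV6 K (g.1 (h.1 (inclV6 K w)))
      = projV6 K (g.1 (inclV6 K (projV6 K (h.1 (inclV6 K w)))))
    conv_lhs => rw [key, map_add, map_smul, octonionAut_map_one, map_add, map_smul]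
    simp [projV6]

/-- `G₂(K)` acts on the subspaces of `PG(5, K)`. -/
instance subspaceAction (K : Type*) [Field K] [CharP K 2] :
    MulAction (G2 K) (Submodule K (V6 K)) where
  smul g U := U.map (rep6 K g)
  one_smul U := by
    change U.map (rep6 K 1) = U
    rw [map_one]
    exact Submodule.map_id U
  mul_smul g h U := by
    change U.map (rep6 K (g * h)) = (U.map (rep6 K h)).map (rep6 K g)
    rw [map_mul]
    exact Submodule.map_comp (rep6 K h) (rep6 K g) U

/-! ## The split Cayley hexagon and the geometry `Γ₂` -/

/-- Grassmann coordinate `p_{ij}` of the line spanned by `X` and `Y`. -/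
def grassmann {K : Type*} [Field K] (X Y : Fin 7 → K) (i j : Fin 7) : K :=
  X i * Y j - X j * Y i

/-- Hexagon lines on the quadric `X₀X₄ + X₁X₅ + X₂X₆ = X₃²` of `PG(6, K)`. -/
def IsHexagonLine7 {K : Type*} [Field K] (L : Submodule K (Fin 7 → K)) : Prop :=
  Module.finrank K L = 2 ∧
  (∀ X ∈ L, X 0 * X 4 + X 1 * X 5 + X 2 * X 6 = X 3 ^ 2) ∧
  ∀ X ∈ L, ∀ Y ∈ L,
    grassmann X Y 1 2 = grassmann X Y 3 4 ∧ grassmann X Y 5 6 = grassmann X Y 0 3 ∧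
    grassmann X Y 4 5 = grassmann X Y 2 3 ∧ grassmann X Y 0 1 = grassmann X Y 3 6 ∧
    grassmann X Y 0 2 = -grassmann X Y 3 5 ∧ grassmann X Y 4 6 = -grassmann X Y 1 3

/-- Projection of `PG(6, K)` from the point `(0, 0, 0, 1, 0, 0, 0)` onto the hyperplane
`X₃ = 0`, which is `PG(5, K)`. -/
def proj7 (K : Type*) [Field K] : (Fin 7 → K) →ₗ[K] V6 K where
  toFun X := (![X 0, X 1, X 2], ![X 4, X 5, X 6])
  map_add' X Y := by
    refine Prod.ext ?_ ?_ <;> funext i <;> fin_cases i <;> rfl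
  map_smul' c X := by
    refine Prod.ext ?_ ?_ <;> funext i <;> fin_cases i <;> rfl

/-- Hexagon lines in `PG(5, K)`: projections of the hexagon lines on the quadric. -/
def IsHexagonLine {K : Type*} [Field K] (L : Submodule K (V6 K)) : Prop :=
  ∃ L' : Submodule K (Fin 7 → K), IsHexagonLine7 L' ∧ L = L'.map (proj7 K)

/-- The symplectic form, i.e. the polar form of `X₀X₄ + X₁X₅ + X₂X₆` (in characteristic two). -/
def sympForm {K : Type*} [Field K] (x y : V6 K) : K := x.1 ⬝ᵥ y.2 + x.2 ⬝ᵥ y.1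

/-- Elements of type 1: all points of `PG(5, K)`. -/
def IsPoint {K : Type*} [Field K] (p : Submodule K (V6 K)) : Prop :=
  Module.finrank K p = 1

/-- Elements of type 2: the non-symplectic lines of `PG(5, K)`, that is, the lines that are not
totally isotropic. -/
def IsNonsymplecticLine {K : Type*} [Field K] (l : Submodule K (V6 K)) : Prop :=
  Module.finrank K l = 2 ∧ ∃ x ∈ l, ∃ y ∈ l, sympForm x y ≠ 0

/-- Nonsingular planes: the non-symplectic lines in the plane form a dual affine plane, that is,
they are the lines of the plane that miss one fixed point. -/
def IsNonsingularPlane {K : Type*} [Field K] (E : Submodule K (V6 K)) : Prop :=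
  Module.finrank K E = 3 ∧ ∃ c : Submodule K (V6 K), IsPoint c ∧ c ≤ E ∧
    ∀ l : Submodule K (V6 K), l ≤ E → Module.finrank K l = 2 →
      (IsNonsymplecticLine l ↔ ¬ c ≤ l)

/-- Elements of type 3 of `Γ₂`: the special nonsingular planes, that is, the nonsingular planes
that contain a hexagon line. -/
def IsSpecialPlane {K : Type*} [Field K] (E : Submodule K (V6 K)) : Prop :=
  IsNonsingularPlane E ∧ ∃ h : Submodule K (V6 K), IsHexagonLine h ∧ h ≤ E

/-- `p, l, E` is a chamber of `Γ₂`. Incidence is containment for points and lines and for lines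
and planes; a point and a plane are incident if some type 2 element is incident with both. -/
def IsChamber {K : Type*} [Field K] (p l E : Submodule K (V6 K)) : Prop :=
  (IsPoint p ∧ IsNonsymplecticLine l ∧ IsSpecialPlane E) ∧
  p ≤ l ∧ l ≤ E ∧ ∃ m : Submodule K (V6 K), IsNonsymplecticLine m ∧ p ≤ m ∧ m ≤ E

/-! ## Fused amalgams and their universal enveloping groups -/

universe u v

/-- An amalgam of groups over a graded poset `J` with grades `1, …, n`, each of which is met by
every maximal chain. -/
structure Amalgam (J : Type v) [PartialOrder J] [Finite J] (n : ℕ) where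
  /-- the grading -/
  grade : J → ℕ
  grade_mem : ∀ j, grade j ∈ Set.Icc 1 n
  grade_strictMono : StrictMono grade
  exists_grade_of_isMaxChain : ∀ s : Set J, IsMaxChain (· ≤ ·) s →
    ∀ k ∈ Set.Icc 1 n, ∃ j ∈ s, grade j = k
  /-- the members of the amalgam -/
  grp : J → Type u
  [group : ∀ j, Group (grp j)]
  /-- the identifications -/
  map : ∀ {i j : J}, i < j → grp i →* grp j
  map_injective : ∀ {i j : J} (h : i < j), Function.Injective (map h)
  map_map : ∀ {i j k : J} (h : i < j) (h' : j < k) (x : grp i),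
    map h' (map h x) = map (h.trans h') x

attribute [instance] Amalgam.group

/-- A fusion of an amalgam. -/
structure Fusion {J : Type v} [PartialOrder J] [Finite J] {n : ℕ} (A : Amalgam.{u, v} J n) where
  /-- the index of the member that contains the fusing element -/
  j₀ : J
  /-- the index of the source of the fusion -/
  j₁ : J
  /-- the index of the target of the fusion -/
  j₂ : J
  grade₀ : A.grade j₀ = n
  grade₁ : A.grade j₁ = n
  grade₂ : A.grade j₂ = n
  /-- the fusing element -/
  g : A.grp j₀
  /-- a common lower neighbour of `j₀` and `j₁` -/
  i₁ : J
  /-- a common lower neighbour of `j₀` and `j₂` -/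
  i₂ : J
  cov₁₀ : i₁ ⋖ j₀
  cov₁₁ : i₁ ⋖ j₁
  cov₂₀ : i₂ ⋖ j₀
  cov₂₂ : i₂ ⋖ j₂
  /-- the fusing isomorphism -/
  γ : A.grp j₁ ≃* A.grp j₂
  /-- on the member at `i₁`, the isomorphism `γ` is conjugation by `g`, taking place inside the
  member at `j₀` and with values in the member at `i₂` -/
  conj : ∀ x : A.grp i₁, ∃ y : A.grp i₂,
    A.map cov₂₀.lt y = g * A.map cov₁₀.lt x * g⁻¹ ∧ A.map cov₂₂.lt y = γ (A.map cov₁₁.lt x)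
  compat : ∀ (i : J) (h₁ : i < j₁) (h₂ : i < j₂) (x : A.grp i),
    A.map h₂ x = γ (A.map h₁ x)

/-- The relators of the universal enveloping group of the amalgam `A` fused by `F`, on generators
indexed by the disjoint union of the members: products in the members, identifications along the
maps of the amalgam, and the fusion. -/
inductive FusedRel {J : Type v} [PartialOrder J] [Finite J] {n : ℕ} (A : Amalgam.{u, v} J n)
    (F : Fusion A) : FreeGroup (Σ j, A.grp j) → Prop
  | mul (j : J) (x y : A.grp j) : FusedRel A F
      (FreeGroup.of ⟨j, x⟩ * FreeGroup.of ⟨j, y⟩ * (FreeGroup.of ⟨j, x * y⟩)⁻¹)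
  | ident (i j : J) (h : i < j) (x : A.grp i) : FusedRel A F
      (FreeGroup.of ⟨i, x⟩ * (FreeGroup.of ⟨j, A.map h x⟩)⁻¹)
  | fuse (x : A.grp F.j₁) : FusedRel A F
      (FreeGroup.of ⟨F.j₂, F.γ x⟩ *
        (FreeGroup.of ⟨F.j₀, F.g⟩ * FreeGroup.of ⟨F.j₁, x⟩ * (FreeGroup.of ⟨F.j₀, F.g⟩)⁻¹)⁻¹)

/-- The universal enveloping group of a fused amalgam. -/
abbrev UniversalEnvelopingGroup {J : Type v} [PartialOrder J] [Finite J] {n : ℕ}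
    (A : Amalgam.{u, v} J n) (F : Fusion A) : Type _ :=
  PresentedGroup {w | FusedRel A F w}

/-- The canonical map from the disjoint union of the members of a fused amalgam to its universal
enveloping group. -/
def UniversalEnvelopingGroup.of {J : Type v} [PartialOrder J] [Finite J] {n : ℕ}
    (A : Amalgam.{u, v} J n) (F : Fusion A) (j : J) (x : A.grp j) :
    UniversalEnvelopingGroup A F :=
  PresentedGroup.of (⟨j, x⟩ : Σ j, A.grp j)

/-! ## The fused amalgam of parabolics -/

/-- The nodes of the amalgam of parabolics: `p` stands for the stabiliser of `p`, `lπ₁` for the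
common stabiliser of `l` and `π₁`, and so on. -/
inductive ParabolicIndex
  | p | l | π₁ | π₂ | pl | pπ₁ | pπ₂ | lπ₁ | lπ₂ | plπ₁ | plπ₂
  deriving DecidableEq

instance : Fintype ParabolicIndex where
  elems := {.p, .l, .π₁, .π₂, .pl, .pπ₁, .pπ₂, .lπ₁, .lπ₂, .plπ₁, .plπ₂}
  complete := by
    intro x
    cases x <;> decide

/-- The elements (`0`, `1`, `2`, `3` for `p`, `l`, `π₁`, `π₂`) stabilised by the parabolic. -/
def ParabolicIndex.verts : ParabolicIndex → Finset (Fin 4)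
  | p => {0} | l => {1} | π₁ => {2} | π₂ => {3}
  | pl => {0, 1} | pπ₁ => {0, 2} | pπ₂ => {0, 3} | lπ₁ => {1, 2} | lπ₂ => {1, 3}
  | plπ₁ => {0, 1, 2} | plπ₂ => {0, 1, 3}

/-- The nodes are ordered by reverse inclusion of the sets of stabilised elements. -/
instance : PartialOrder ParabolicIndex :=
  PartialOrder.lift (fun i => OrderDual.toDual i.verts) (by decide)

instance : DecidableLE ParabolicIndex := fun i j =>
  inferInstanceAs (Decidable (j.verts ⊆ i.verts))

instance : DecidableLT ParabolicIndex := fun i j =>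
  inferInstanceAs (Decidable (j.verts ⊂ i.verts))

/-- The grading: `3` for the stabilisers of elements, `2` for intersections of two of them and
`1` for intersections of three. -/
def ParabolicIndex.grade (i : ParabolicIndex) : ℕ := 4 - i.verts.card

/-- The subgroup at a node of the amalgam of parabolics. -/
def parabolic {G X : Type*} [Group G] [MulAction G X] (p l π₁ π₂ : X) :
    ParabolicIndex → Subgroup G
  | .p => MulAction.stabilizer G p
  | .l => MulAction.stabilizer G l
  | .π₁ => MulAction.stabilizer G π₁
  | .π₂ => MulAction.stabilizer G π₂
  | .pl => MulAction.stabilizer G p ⊓ MulAction.stabilizer G l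
  | .pπ₁ => MulAction.stabilizer G p ⊓ MulAction.stabilizer G π₁
  | .pπ₂ => MulAction.stabilizer G p ⊓ MulAction.stabilizer G π₂
  | .lπ₁ => MulAction.stabilizer G l ⊓ MulAction.stabilizer G π₁
  | .lπ₂ => MulAction.stabilizer G l ⊓ MulAction.stabilizer G π₂
  | .plπ₁ => MulAction.stabilizer G p ⊓ MulAction.stabilizer G l ⊓ MulAction.stabilizer G π₁
  | .plπ₂ => MulAction.stabilizer G p ⊓ MulAction.stabilizer G l ⊓ MulAction.stabilizer G π₂

theorem mem_parabolic_iff {G X : Type*} [Group G] [MulAction G X] (p l π₁ π₂ : X)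
    (i : ParabolicIndex) (g : G) :
    g ∈ parabolic (G := G) p l π₁ π₂ i ↔ ∀ k ∈ i.verts, g • ![p, l, π₁, π₂] k = ![p, l, π₁, π₂] k := by
  cases i <;> simp [parabolic, ParabolicIndex.verts, Subgroup.mem_inf, and_assoc]

theorem parabolic_mono {G X : Type*} [Group G] [MulAction G X] (p l π₁ π₂ : X)
    {i j : ParabolicIndex} (h : i ≤ j) :
    parabolic (G := G) p l π₁ π₂ i ≤ parabolic (G := G) p l π₁ π₂ j := by
  intro g hg
  rw [mem_parabolic_iff] at hg ⊢
  exact fun k hk => hg k (h hk)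

theorem ParabolicIndex.exists_grade_of_isMaxChain (s : Set ParabolicIndex)
    (hs : IsMaxChain (· ≤ ·) s) (k : ℕ) (hk : k ∈ Set.Icc 1 3) : ∃ j ∈ s, j.grade = k := by
  have hmem : ∀ m : ParabolicIndex, (∀ x ∈ s, m ≤ x ∨ x ≤ m) → m ∈ s := by
    intro m hm
    have h := hs.2 (hs.1.insert fun x hx _ => hm x hx) (Set.subset_insert m s)
    rw [h]
    exact Set.mem_insert m s
  have hne : s.Nonempty := by
    by_contra h
    rw [Set.not_nonempty_iff_eq_empty] at h
    have := hmem .p (by simp [h])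
    simp [h] at this
  obtain ⟨a, has, hamin⟩ := s.toFinite.exists_minimal hne
  obtain ⟨b, hbs, hbmax⟩ := s.toFinite.exists_maximal hne
  have ha : ∀ x ∈ s, a ≤ x := fun x hx =>
    (hs.1.total has hx).elim id fun h => hamin hx h
  have hb : ∀ x ∈ s, x ≤ b := fun x hx =>
    (hs.1.total hx hbs).elim id fun h => hbmax hx h
  have f1 : ∀ x : ParabolicIndex, x.grade = 1 ∨ ∃ m, m < x := by decide
  have f3 : ∀ x : ParabolicIndex, x.grade = 3 ∨ ∃ m, x < m := by decide
  have f2 : ∀ x y : ParabolicIndex, x.grade = 1 → y.grade = 3 → x ≤ y →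
      ∃ m, m.grade = 2 ∧ x ≤ m ∧ m ≤ y := by decide
  have f4 : ∀ x y : ParabolicIndex, x ≤ y → x = y ∨ x.grade < y.grade := by decide
  have ga : a.grade = 1 := by
    rcases f1 a with h | ⟨m, hm⟩
    · exact h
    · have := ha m (hmem m fun x hx => Or.inl (hm.le.trans (ha x hx)))
      exact absurd hm this.not_gt
  have gb : b.grade = 3 := by
    rcases f3 b with h | ⟨m, hm⟩
    · exact h
    · have := hb m (hmem m fun x hx => Or.inr ((hb x hx).trans hm.le))
      exact absurd hm this.not_gt
  obtain ⟨hk1, hk3⟩ := hk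
  interval_cases k
  · exact ⟨a, has, ga⟩
  · by_contra hcon
    push Not at hcon
    obtain ⟨m, gm, ham, hmb⟩ := f2 a b ga gb (ha b hbs)
    refine hcon m (hmem m fun x hx => ?_) gm
    rcases f4 a x (ha x hx) with h | h
    · exact Or.inr (h ▸ ham)
    · rcases f4 x b (hb x hx) with h' | h'
      · exact Or.inl (h' ▸ hmb)
      · exact absurd (by omega) (hcon x hx)
  · exact ⟨b, hbs, gb⟩

/-- The amalgam of parabolics for the action of `G` on `X` and `p, l, π₁, π₂` in `X`, with
inclusions as maps. -/
def parabolicAmalgam (G : Type*) {X : Type*} [Group G] [MulAction G X] (p l π₁ π₂ : X) :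
    Amalgam ParabolicIndex 3 where
  grade := ParabolicIndex.grade
  grade_mem := by
    intro j
    cases j <;> decide
  grade_strictMono := by
    have h : ∀ i j : ParabolicIndex, i < j → i.grade < j.grade := by decide
    exact fun i j hij => h i j hij
  exists_grade_of_isMaxChain := ParabolicIndex.exists_grade_of_isMaxChain
  grp := fun j => ↥(parabolic (G := G) p l π₁ π₂ j)
  map := fun h => Subgroup.inclusion (parabolic_mono p l π₁ π₂ h.le)
  map_injective := fun h => Subgroup.inclusion_injective (parabolic_mono p l π₁ π₂ h.le)
  map_map := fun _ _ _ => rfl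

/-- The fusion of the amalgam of parabolics by conjugation with `g`, where `g` stabilises `l` and
maps `π₁` to `π₂`. -/
def parabolicFusion {G X : Type*} [Group G] [MulAction G X] (p l π₁ π₂ : X)
    (g : G) (hg : g ∈ MulAction.stabilizer G l) (hπ : π₂ = g • π₁) :
    Fusion (parabolicAmalgam G p l π₁ π₂) where
  j₀ := .l
  j₁ := .π₁
  j₂ := .π₂
  grade₀ := rfl
  grade₁ := rfl
  grade₂ := rfl
  g := ⟨g, hg⟩
  i₁ := .lπ₁
  i₂ := .lπ₂
  cov₁₀ := ⟨by decide, by decide⟩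
  cov₁₁ := ⟨by decide, by decide⟩
  cov₂₀ := ⟨by decide, by decide⟩
  cov₂₂ := ⟨by decide, by decide⟩
  γ := MulAction.stabilizerEquivStabilizer hπ
  conj := by
    rintro ⟨x, hx⟩
    have hx' : x ∈ MulAction.stabilizer G l ⊓ MulAction.stabilizer G π₁ := hx
    have hy : g * x * g⁻¹ ∈ MulAction.stabilizer G l ⊓ MulAction.stabilizer G π₂ := by
      have h1 : g * x * g⁻¹ ∈ MulAction.stabilizer G l :=
        Subgroup.mul_mem _ (Subgroup.mul_mem _ hg hx'.1) (Subgroup.inv_mem _ hg)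
      have h2 : g * x * g⁻¹ ∈ MulAction.stabilizer G π₂ := by
        have h3 : x • π₁ = π₁ := hx'.2
        rw [MulAction.mem_stabilizer_iff, hπ, smul_smul, inv_mul_cancel_right, mul_smul, h3]
      exact ⟨h1, h2⟩
    exact ⟨⟨g * x * g⁻¹, hy⟩, rfl, rfl⟩
  compat := by
    intro i h₁ h₂
    exfalso
    revert i
    decide

/-!
# `G₂(K)` as the universal enveloping group of a fused amalgam of parabolics

The proof is a covering argument for the graph `NonPerp` on the points of `PG(5, K)`, in which two
points are adjacent if they are not orthogonal, so that an edge is contained in a unique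
nonsymplectic line.

Let `U` be the universal enveloping group and `φ : U → G₂(K)` the canonical map. The generators that
belong to the stabiliser of `p` form a subgroup of `U` on which `φ` is injective; the cosets of this
subgroup are the vertices of a graph that covers `NonPerp`. Edges lift uniquely because the
stabiliser of `p` and that of `l` agree in `U` on the stabiliser of both. Triangles in a special
plane lift because of the stabiliser of the plane. The points of the plane other than its radical
form two orbits under its stabiliser, represented by `p` and `g⁻¹ • p`: all points of `l` but one
form an orbit of the stabiliser of `l` and `π₁`, and as `π₁` and `π₂ = g • π₁` are not conjugate
under the stabiliser of `p` and `l`, exactly one of `p` and `g⁻¹ • p` is the exceptional point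
(`IsStdFlag.exists_eq_smul`). The points of the second kind are controlled by the stabiliser of `p`
and `π₂`, and this is where the fusion comes in (`parabolicStabilizerLift`).

Every triangle lifts, since it either lies in a special plane or is filled by three triangles that
do (`exists_fill_std`): `G₂(K)` is transitive on hyperbolic pairs, so two of its vertices may be
taken as the points spanned by `E0 K` and `E4 K`; all three then lie in a special plane unless they
span a plane whose radical is nonsingular, and a nonsingular vector is a sum of two singular ones.
The radical is relevant because a plane on the standard hyperbolic line that contains a hexagon line
has a singular radical (`IsNullPlane.singular`), and because `G₂(K)` is transitive on the pairs of a
nonsymplectic line in a special plane (`isStdFlag_of_isSpecialPlane`).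

By nondegeneracy of the symplectic form few points always have a common neighbour
(`hasCommonNeighbours_nonPerp`). Hence all circuits of the graph decompose into triangles, the
covering is trivial on each connected component, and as `U` is generated by the stabilisers of `p`,
`l` and `π₁` it is connected. So the kernel of `φ` fixes the base coset and is trivial
(`StabilizerLift.bijective`). Perfectness of `K` enters through the transitivity of `G₂(K)` on
nonzero vectors and on hyperbolic pairs, where square roots have to be extracted.
-/

/-! ### Coverings of graphs -/

section Covering

variable {X Y : Type*}

/-- `E` is a graph on `Y` that covers the graph `adj` on `X` via `pr`: edges lift uniquely to a
given starting vertex, and every triangle of `X` lifts to a triangle. -/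
structure IsTriangleCovering (adj : X → X → Prop) (pr : Y → X) (E : Y → Y → Prop) : Prop where
  symm : ∀ {a b}, E a b → E b a
  map : ∀ {a b}, E a b → adj (pr a) (pr b)
  lift : ∀ {a y}, adj (pr a) y → ∃ b, pr b = y ∧ E a b
  unique : ∀ {a b b'}, E a b → E a b' → pr b = pr b' → b = b'
  triangle : ∀ {a b c}, E a b → E b c → adj (pr a) (pr c) → E a c

/-- A graph in which few vertices always have a common neighbour. These conditions make every
circuit a product of triangles, so that the triangle coverings are trivial. -/
structure HasCommonNeighbours (adj : X → X → Prop) : Prop where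
  symm : ∀ {x y}, adj x y → adj y x
  pair : ∀ {x y x' y'}, adj x x' → adj y y' → ∃ z, adj x z ∧ adj z y
  edge : ∀ {x x' y z}, adj x x' → adj y z →
    (adj x y ∧ adj x z) ∨ ∃ w, adj x w ∧ adj w y ∧ adj w z
  square : ∀ {x y z z'}, adj x z → adj z y → adj x z' → adj z' y →
    adj x y ∨ z = z' ∨ adj z z' ∨ ∃ w, adj x w ∧ adj w y ∧ adj w z ∧ adj w z'

/-- The vertices at the end of a walk of length two from `a`. -/
def twoStep (E : Y → Y → Prop) (a : Y) : Set Y := {b | ∃ c, E a c ∧ E c b}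

variable {adj : X → X → Prop} {pr : Y → X} {E : Y → Y → Prop}

/-- Any two walks of length two with the same start and the same end in `X` have the same end in
`Y`: a quadrangle of `X` is filled by triangles. -/
theorem IsTriangleCovering.injOn_twoStep (hE : IsTriangleCovering adj pr E)
    (hadj : HasCommonNeighbours adj) (a : Y) : Set.InjOn pr (twoStep E a) := by
  rintro b ⟨c, hac, hcb⟩ b' ⟨c', hac', hcb'⟩ hbb
  have h1 := hE.map hac
  have h2 := hE.map hcb
  have h3 := hE.map hac'
  have h4 := hE.map hcb'
  rw [← hbb] at h4
  rcases hadj.square h1 h2 h3 h4 with h | h | h | ⟨w, hw1, hw2, hw3, hw4⟩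
  · exact hE.unique (hE.triangle hac hcb h) (hE.triangle hac' hcb' (hbb ▸ h)) hbb
  · obtain rfl := hE.unique hac hac' h
    exact hE.unique hcb hcb' hbb
  · have hcc : E c c' := hE.triangle (hE.symm hac) hac' h
    exact hE.unique hcb (hE.triangle hcc hcb' (hbb ▸ h2)) hbb
  · obtain ⟨d, rfl, had⟩ := hE.lift hw1
    have hcd : E c d := hE.triangle (hE.symm hac) had (hadj.symm hw3)
    have hcd' : E c' d := hE.triangle (hE.symm hac') had (hadj.symm hw4)
    have hdb : E d b := hE.triangle (hE.symm hcd) hcb hw2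
    have hdb' : E d b' := hE.triangle (hE.symm hcd') hcb' (hbb ▸ hw2)
    exact hE.unique hdb hdb' hbb

theorem IsTriangleCovering.mem_twoStep_of_adj (hE : IsTriangleCovering adj pr E)
    (hadj : HasCommonNeighbours adj) {a b : Y} (hab : E a b) : b ∈ twoStep E a := by
  obtain ⟨z, hz1, hz2⟩ := hadj.pair (hE.map hab) (hE.map (hE.symm hab))
  obtain ⟨c, rfl, hac⟩ := hE.lift hz1
  exact ⟨c, hac, hE.triangle (hE.symm hac) hab hz2⟩

theorem IsTriangleCovering.self_mem_twoStep (hE : IsTriangleCovering adj pr E)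
    {a b : Y} (hab : E a b) : a ∈ twoStep E a := ⟨b, hab, hE.symm hab⟩

/-- The set of vertices reached in two steps is closed under taking neighbours. -/
theorem IsTriangleCovering.twoStep_closed (hE : IsTriangleCovering adj pr E)
    (hadj : HasCommonNeighbours adj) {a b b' : Y} (hb : b ∈ twoStep E a) (hbb : E b b') :
    b' ∈ twoStep E a := by
  obtain ⟨c, hac, hcb⟩ := id hb
  rcases hadj.edge (hE.map hac) (hE.map hbb) with ⟨h, h'⟩ | ⟨w, hw1, hw2, hw3⟩
  · exact hE.mem_twoStep_of_adj hadj (hE.triangle (hE.triangle hac hcb h) hbb h')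
  · obtain ⟨d, rfl, had⟩ := hE.lift hw1
    obtain ⟨e, he, hde⟩ := hE.lift hw2
    obtain rfl := hE.injOn_twoStep hadj a ⟨d, had, hde⟩ hb he
    exact ⟨d, had, hE.triangle hde hbb hw3⟩

end Covering

/-! ### Groups generated by lifts of stabilisers -/

section Amalgam

variable {G U X : Type*} [Group G] [Group U] [MulAction G X]

/-- A group `U` over `G` that is generated by lifts of the stabilisers of `p`, `l` and `π` which
agree on intersections; moreover, conjugation by the lift of `d`, for `d` in a set `D` of elements
that stabilise `l`, takes the lift of the stabiliser of `p` and `d⁻¹ • π` to the lift of the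
stabiliser of `d • p` and `π`. -/
structure StabilizerLift (φ : U →* G) (p l π : X) (D : Set G) where
  /-- the lift of the stabiliser of `p` -/
  liftP : MulAction.stabilizer G p →* U
  /-- the lift of the stabiliser of `l` -/
  liftL : MulAction.stabilizer G l →* U
  /-- the lift of the stabiliser of `π` -/
  liftPi : MulAction.stabilizer G π →* U
  map_liftP : ∀ x, φ (liftP x) = x
  map_liftL : ∀ x, φ (liftL x) = x
  map_liftPi : ∀ x, φ (liftPi x) = x
  liftP_eq_liftL : ∀ (x : G) (h : x ∈ MulAction.stabilizer G p)
    (h' : x ∈ MulAction.stabilizer G l), liftP ⟨x, h⟩ = liftL ⟨x, h'⟩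
  liftL_eq_liftPi : ∀ (x : G) (h : x ∈ MulAction.stabilizer G l)
    (h' : x ∈ MulAction.stabilizer G π), liftL ⟨x, h⟩ = liftPi ⟨x, h'⟩
  mem_stabilizer : ∀ d ∈ D, d ∈ MulAction.stabilizer G l
  one_mem : 1 ∈ D
  conj : ∀ (d : G) (hd : d ∈ MulAction.stabilizer G l) (x : G)
    (h : x ∈ MulAction.stabilizer G π) (h' : d⁻¹ * x * d ∈ MulAction.stabilizer G p), d ∈ D →
    (liftL ⟨d, hd⟩)⁻¹ * liftPi ⟨x, h⟩ * liftL ⟨d, hd⟩ = liftP ⟨d⁻¹ * x * d, h'⟩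
  generate : liftP.range ⊔ liftL.range ⊔ liftPi.range = ⊤

/-- The facts about a graph on the `G`-orbit of `p` that make a `StabilizerLift` trivial. Here `l`
is a line through `p`, its points being the images of `p` under the stabiliser of `l`, and
`π` is a plane on `l`, whose points are the images of the points `d • p` with `d` in `D` under the
stabiliser of `π`. -/
structure IsFlagGraph (adj : X → X → Prop) (p l π : X) (D : Set G) : Prop where
  common : HasCommonNeighbours adj
  smul : ∀ (g : G) {x y}, adj x y → adj (g • x) (g • y)
  exists_adj : ∃ y, adj p y
  /-- every edge at `p` lies in an image of `l` -/
  edge : ∀ y, adj p y → ∃ h k : G, h • p = p ∧ k • l = l ∧ y = h • k • p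
  /-- two distinct points of `l` are adjacent -/
  line_adj : ∀ k : G, k • l = l → k • p = p ∨ adj p (k • p)
  /-- `l` is determined by two of its points -/
  line_unique : ∀ h k k' : G, h • p = p → k • l = l → k' • l = l → adj p (k • p) →
    adj p (k' • p) → k • p = h • k' • p → h • l = l
  /-- every edge of `π` at a representative point can be moved into `l` -/
  plane_edge : ∀ d ∈ D, ∀ d' ∈ D, ∀ k : G, k • π = π → adj (d • p) (k • d' • p) →
    ∃ n m : G, n • π = π ∧ n • d • p = d • p ∧ m • l = l ∧ m • π = π ∧ n • k • d' • p = m • d' • p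
  /-- `π` is connected -/
  plane_connected : ∀ k : G, k • π = π → ∃ n : G, n • π = π ∧ ∃ d ∈ D,
    adj p (n • d • p) ∧ adj (n • d • p) (k • p)
  /-- every triangle is filled by at most three triangles in images of `π` -/
  triangle : ∀ x y z, adj x y → adj y z → adj x z →
    let good := fun a b c : X => ∃ u : G, ∀ t ∈ ({a, b, c} : Set X),
      ∃ k : G, k • π = π ∧ ∃ d ∈ D, t = u • k • d • p
    good x y z ∨ ∃ w, adj w x ∧ adj w y ∧ adj w z ∧ good x y w ∧ good y z w ∧ good x z w

namespace StabilizerLift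

variable {φ : U →* G} {p l π : X} {D : Set G} (S : StabilizerLift φ p l π D)

/-- The points of the covering: cosets of the lift of the stabiliser of `p`. -/
abbrev Pt : Type _ := U ⧸ S.liftP.range

/-- The base point of the covering. -/
def base : S.Pt := ((1 : U) : U ⧸ S.liftP.range)

/-- The projection of the covering. -/
def proj : S.Pt → X :=
  Quotient.lift (fun u : U => φ u • p) (by
    intro a b hab
    obtain ⟨x, hx⟩ := QuotientGroup.leftRel_apply.1 hab
    have h : φ b = φ a * x := by rw [← S.map_liftP, hx, ← map_mul, mul_inv_cancel_left]
    change φ a • p = φ b • p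
    rw [h, mul_smul, (x.2 : (x : G) • p = p)])

theorem exists_smul_base (a : S.Pt) : ∃ u : U, a = u • S.base := by
  induction a using QuotientGroup.induction_on with
  | H u => exact ⟨u, by simp [base]⟩

theorem proj_smul_base (u : U) : S.proj (u • S.base) = φ u • p := by
  change φ (u * 1) • p = _
  rw [mul_one]

theorem proj_smul (u : U) (a : S.Pt) : S.proj (u • a) = φ u • S.proj a := by
  obtain ⟨v, rfl⟩ := S.exists_smul_base a
  rw [smul_smul, proj_smul_base, proj_smul_base, map_mul, mul_smul]

theorem smul_base_eq_iff (u : U) : u • S.base = S.base ↔ ∃ x, S.liftP x = u := by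
  change (((u * 1 : U) : U ⧸ S.liftP.range) = ((1 : U) : U ⧸ S.liftP.range)) ↔ _
  rw [mul_one, eq_comm, QuotientGroup.eq, inv_one, one_mul, MonoidHom.mem_range]

theorem liftP_smul_base (x : MulAction.stabilizer G p) : S.liftP x • S.base = S.base :=
  (S.smul_base_eq_iff _).2 ⟨x, rfl⟩

/-- Adjacency in the covering: two points are adjacent if some `u` moves them to the base point
and its image under the lift of an element of the stabiliser of `l`. -/
def Edge (adj : X → X → Prop) (a b : S.Pt) : Prop :=
  ∃ (u : U) (k : MulAction.stabilizer G l),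
    a = u • S.base ∧ b = u • S.liftL k • S.base ∧ adj p ((k : G) • p)

variable {S} {adj : X → X → Prop}

theorem Edge.smul {a b : S.Pt} (h : S.Edge adj a b) (v : U) : S.Edge adj (v • a) (v • b) := by
  obtain ⟨u, k, rfl, rfl, hk⟩ := h
  exact ⟨v * u, k, by rw [mul_smul], by rw [mul_smul], hk⟩

variable (F : IsFlagGraph (G := G) adj p l π D)
include F

theorem Edge.symm {a b : S.Pt} (h : S.Edge adj a b) : S.Edge adj b a := by
  obtain ⟨u, k, rfl, rfl, hk⟩ := h
  refine ⟨u * S.liftL k, k⁻¹, by rw [mul_smul], ?_, ?_⟩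
  · rw [map_inv, mul_smul, smul_inv_smul]
  · have := F.smul (k : G)⁻¹ (F.common.symm hk)
    rwa [inv_smul_smul] at this

theorem Edge.map {a b : S.Pt} (h : S.Edge adj a b) : adj (S.proj a) (S.proj b) := by
  obtain ⟨u, k, rfl, rfl, hk⟩ := h
  rw [proj_smul_base, proj_smul, proj_smul_base, map_liftL]
  exact F.smul _ hk

theorem exists_edge {a : S.Pt} {y : X} (h : adj (S.proj a) y) :
    ∃ b, S.proj b = y ∧ S.Edge adj a b := by
  obtain ⟨u, rfl⟩ := S.exists_smul_base a
  rw [proj_smul_base] at h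
  have h' := F.smul (φ u)⁻¹ h
  rw [inv_smul_smul] at h'
  obtain ⟨x, k, hx, hk, hy⟩ := F.edge _ h'
  have hxk : adj p (k • p) := by
    have := F.smul x⁻¹ (hy ▸ h')
    rwa [inv_smul_smul, inv_smul_eq_iff.2 hx.symm] at this
  refine ⟨(u * S.liftP ⟨x, hx⟩) • S.liftL ⟨k, hk⟩ • S.base, ?_, _, ⟨k, hk⟩, ?_, rfl, hxk⟩
  · rw [proj_smul, proj_smul_base, map_mul, map_liftP, map_liftL, mul_smul, ← hy, smul_inv_smul]
  · rw [mul_smul, liftP_smul_base]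

theorem Edge.unique {a b b' : S.Pt} (h : S.Edge adj a b) (h' : S.Edge adj a b')
    (hb : S.proj b = S.proj b') : b = b' := by
  obtain ⟨u, k, rfl, rfl, hk⟩ := h
  obtain ⟨u', k', hu, rfl, hk'⟩ := h'
  obtain ⟨x, hx⟩ := (S.smul_base_eq_iff (u⁻¹ * u')).1 (by rw [mul_smul, ← hu, inv_smul_smul])
  obtain rfl : u' = u * S.liftP x := by rw [hx, mul_inv_cancel_left]
  rw [proj_smul, proj_smul_base, proj_smul, proj_smul_base, map_mul, map_liftL, map_liftL,
    map_liftP, mul_smul, smul_left_cancel_iff] at hb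
  have hxl : (x : G) • l = l := F.line_unique x k k' x.2 k.2 k'.2 hk hk' hb
  let e : MulAction.stabilizer G l := k⁻¹ * (⟨x, hxl⟩ * k')
  have hj : (e : G) • p = p := by
    change ((k : G)⁻¹ * ((x : G) * (k' : G))) • p = p
    rw [mul_smul, mul_smul, ← hb, inv_smul_smul]
  have key : S.liftP x * S.liftL k' = S.liftL k * S.liftP ⟨_, hj⟩ := by
    rw [S.liftP_eq_liftL _ hj e.2, show x = ⟨(x : G), x.2⟩ from rfl,
      S.liftP_eq_liftL _ x.2 hxl, ← map_mul, ← map_mul]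
    congr 1
    exact (mul_inv_cancel_left k _).symm
  rw [mul_smul, smul_left_cancel_iff, smul_smul, key, mul_smul, liftP_smul_base]

/-- Edges of the covering above the edges of a line. -/
theorem edge_line {k k' : MulAction.stabilizer G l} (h : adj ((k : G) • p) ((k' : G) • p)) :
    S.Edge adj (S.liftL k • S.base) (S.liftL k' • S.base) := by
  refine ⟨S.liftL k, k⁻¹ * k', rfl, ?_, ?_⟩
  · rw [map_mul, map_inv, mul_smul, smul_inv_smul]
  · have := F.smul (k : G)⁻¹ h
    rw [inv_smul_smul] at this
    change adj p (((k : G)⁻¹ * (k' : G)) • p)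
    rwa [mul_smul]

omit F in
theorem liftPi_smul_base {d : G} (hd : d ∈ D) {x : MulAction.stabilizer G π}
    (hx : (x : G) • d • p = d • p) :
    S.liftPi x • S.liftL ⟨d, S.mem_stabilizer d hd⟩ • S.base =
      S.liftL ⟨d, S.mem_stabilizer d hd⟩ • S.base := by
  have h' : (d⁻¹ * (x : G) * d) • p = p := by
    rw [mul_smul, mul_smul, hx, inv_smul_smul]
  rw [← inv_smul_eq_iff, smul_smul, smul_smul,
    S.conj d (S.mem_stabilizer d hd) x x.2 h' hd, liftP_smul_base]

/-- Edges of the covering above the edges of a plane. -/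
theorem edge_plane {d d' : G} (hd : d ∈ D) (hd' : d' ∈ D) {k k' : MulAction.stabilizer G π}
    (h : adj ((k : G) • d • p) ((k' : G) • d' • p)) :
    S.Edge adj (S.liftPi k • S.liftL ⟨d, S.mem_stabilizer d hd⟩ • S.base)
      (S.liftPi k' • S.liftL ⟨d', S.mem_stabilizer d' hd'⟩ • S.base) := by
  have h1 : adj (d • p) (((k⁻¹ * k' : MulAction.stabilizer G π) : G) • d' • p) := by
    have := F.smul (k : G)⁻¹ h
    rw [inv_smul_smul] at this
    change adj (d • p) (((k : G)⁻¹ * (k' : G)) • d' • p)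
    rwa [mul_smul]
  obtain ⟨n, m, hn, hnd, hml, hmp, hnm⟩ := F.plane_edge d hd d' hd' _ (k⁻¹ * k').2 h1
  -- After translation by `n` both ends are lifts of points of `l`.
  have h2 : S.liftPi ⟨n, hn⟩ • S.liftPi (k⁻¹ * k') • S.liftL ⟨d', S.mem_stabilizer d' hd'⟩ •
      S.base = S.liftL ⟨m, hml⟩ • S.liftL ⟨d', S.mem_stabilizer d' hd'⟩ • S.base := by
    have hx : (((⟨m, hmp⟩ : MulAction.stabilizer G π)⁻¹ * (⟨n, hn⟩ * (k⁻¹ * k')) :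
        MulAction.stabilizer G π) : G) • d' • p = d' • p := by
      change ((m⁻¹ * (n * ((k⁻¹ * k' : MulAction.stabilizer G π) : G))) • d' • p) = d' • p
      rw [mul_smul, mul_smul, hnm, inv_smul_smul]
    have h3 := liftPi_smul_base (S := S) hd' hx
    rwa [map_mul, map_inv, ← S.liftL_eq_liftPi m hml hmp, mul_smul, inv_smul_eq_iff, map_mul,
      mul_smul] at h3
  have h4 : S.Edge adj (S.liftL ⟨d, S.mem_stabilizer d hd⟩ • S.base)
      (S.liftL (⟨m, hml⟩ * ⟨d', S.mem_stabilizer d' hd'⟩) • S.base) := by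
    apply edge_line F
    have := F.smul n h1
    rw [hnd, hnm] at this
    change adj (d • p) ((m * d') • p)
    rwa [mul_smul]
  have h5 := h4.smul (S.liftPi k * (S.liftPi ⟨n, hn⟩)⁻¹)
  rwa [map_mul, mul_smul (S.liftL _), ← h2, mul_smul, mul_smul, inv_smul_smul,
    inv_smul_eq_iff.2 (liftPi_smul_base (S := S) hd (x := ⟨n, hn⟩) hnd).symm,
    smul_smul (S.liftPi k) (S.liftPi (k⁻¹ * k')), ← map_mul, mul_inv_cancel_left] at h5

/-- The map `φ` is onto, as the graph is connected. -/
theorem surjective (S : StabilizerLift φ p l π D) : Function.Surjective φ := by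
  intro g
  obtain ⟨y, hy⟩ := F.exists_adj
  obtain ⟨z, hz, hz'⟩ := F.common.pair hy (F.smul g hy)
  obtain ⟨c, rfl, hc⟩ := exists_edge F (S := S) (a := S.base)
    (by rw [← one_smul U S.base, proj_smul_base, map_one, one_smul]; exact hz)
  obtain ⟨b, hb, -⟩ := exists_edge F hz'
  obtain ⟨u, rfl⟩ := S.exists_smul_base b
  rw [proj_smul_base] at hb
  have hx : ((φ u)⁻¹ * g) • p = p := by rw [mul_smul, ← hb, inv_smul_smul]
  exact ⟨u * S.liftP ⟨_, hx⟩, by rw [map_mul, map_liftP, mul_inv_cancel_left]⟩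

omit F in
theorem exists_smul_eq_of_proj_eq {a b : S.Pt} (h : S.proj a = S.proj b) :
    ∃ v : U, φ v = 1 ∧ a = v • b := by
  obtain ⟨u, rfl⟩ := S.exists_smul_base a
  obtain ⟨u', rfl⟩ := S.exists_smul_base b
  rw [proj_smul_base, proj_smul_base] at h
  have hx : ((φ u)⁻¹ * φ u') • p = p := by rw [mul_smul, ← h, inv_smul_smul]
  refine ⟨u * S.liftP ⟨_, hx⟩ * u'⁻¹, ?_, ?_⟩
  · rw [map_mul, map_mul, map_liftP, map_inv]
    group
  · rw [mul_smul, inv_smul_smul, mul_smul, liftP_smul_base]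

/-- A triangle lifts to a triangle if its vertices lie in an image of a set of points to which
all edges between its members lift. -/
theorem Edge.triangle_of_subset (T : Set S.Pt)
    (hT : ∀ s ∈ T, ∀ t ∈ T, adj (S.proj s) (S.proj t) → S.Edge adj s t) {a b c : S.Pt}
    (hab : S.Edge adj a b) (hbc : S.Edge adj b c) (hac : adj (S.proj a) (S.proj c)) (u : G)
    (hu : ∀ t ∈ ({S.proj a, S.proj b, S.proj c} : Set X), ∃ s ∈ T, t = u • S.proj s) :
    S.Edge adj a c := by
  obtain ⟨v, rfl⟩ := surjective F S u
  obtain ⟨s, hs, ha⟩ := hu (S.proj a) (by simp)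
  obtain ⟨t, ht, hb⟩ := hu (S.proj b) (by simp)
  obtain ⟨r, hr, hc⟩ := hu (S.proj c) (by simp)
  rw [← proj_smul] at ha
  obtain ⟨w, hw, rfl⟩ := exists_smul_eq_of_proj_eq ha
  rw [smul_smul] at *
  have hproj : ∀ s, S.proj ((w * v) • s) = φ v • S.proj s := fun s => by
    rw [proj_smul, map_mul, hw, one_mul]
  have hedge : ∀ s ∈ T, ∀ t ∈ T, adj (S.proj ((w * v) • s)) (S.proj ((w * v) • t)) →
      S.Edge adj ((w * v) • s) ((w * v) • t) := by
    intro s hs t ht h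
    rw [proj_smul, proj_smul] at h
    have := F.smul (φ (w * v))⁻¹ h
    rw [inv_smul_smul, inv_smul_smul] at this
    exact (hT s hs t ht this).smul _
  rw [← hproj] at hb hc
  obtain rfl := Edge.unique F hab (hedge s hs t ht (hb ▸ Edge.map F hab)) hb
  obtain rfl := Edge.unique F hbc (hedge t ht r hr (hc ▸ Edge.map F hbc)) hc
  exact hedge s hs r hr hac

theorem isTriangleCovering (S : StabilizerLift φ p l π D) :
    IsTriangleCovering adj S.proj (S.Edge adj) where
  symm := Edge.symm F
  map := Edge.map F
  lift := exists_edge F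
  unique := Edge.unique F
  triangle := by
    intro a b c hab hbc hac
    have good : ∀ {a b c : S.Pt}, S.Edge adj a b → S.Edge adj b c → adj (S.proj a) (S.proj c) →
        (∃ u : G, ∀ t ∈ ({S.proj a, S.proj b, S.proj c} : Set X),
          ∃ k : G, k • π = π ∧ ∃ d ∈ D, t = u • k • d • p) → S.Edge adj a c := by
      rintro a b c hab hbc hac ⟨u, hu⟩
      refine Edge.triangle_of_subset F {s | ∃ (k : _) (d : G) (hd : d ∈ D),
        s = S.liftPi k • S.liftL ⟨d, S.mem_stabilizer d hd⟩ • S.base} ?_ hab hbc hac u ?_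
      · rintro _ ⟨k, d, hd, rfl⟩ _ ⟨k', d', hd', rfl⟩ h
        rw [proj_smul, proj_smul_base, proj_smul, proj_smul_base, map_liftPi, map_liftPi,
          map_liftL, map_liftL] at h
        exact edge_plane F hd hd' h
      · intro t ht
        obtain ⟨k, hk, d, hd, rfl⟩ := hu t ht
        exact ⟨_, ⟨⟨k, hk⟩, d, hd, rfl⟩, by rw [proj_smul, proj_smul_base, map_liftPi, map_liftL]⟩
    rcases F.triangle _ _ _ (Edge.map F hab) (Edge.map F hbc) hac with h | ⟨w, hw⟩
    · exact good hab hbc hac h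
    · obtain ⟨hwa, hwb, hwc, h1, h2, h3⟩ := hw
      obtain ⟨e, rfl, hae⟩ := exists_edge F (F.common.symm hwa)
      -- the triangles `b, a, e`, then `b, e, c`, then `a, e, c`
      have hbe : S.Edge adj b e := by
        refine good (Edge.symm F hab) hae (F.common.symm hwb) ?_
        rwa [Set.insert_comm]
      have hec : S.Edge adj e c := by
        refine good (Edge.symm F hbe) hbc hwc ?_
        rwa [show ({S.proj e, S.proj b, S.proj c} : Set X) = {S.proj b, S.proj c, S.proj e} by
          rw [Set.insert_comm, Set.pair_comm (S.proj e)]]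
      refine good hae hec hac ?_
      rwa [Set.pair_comm (S.proj e)]

/-- A group that is generated by compatible lifts of the stabilisers is the group itself. -/
theorem bijective (S : StabilizerLift φ p l π D) : Function.Bijective φ := by
  refine ⟨(injective_iff_map_eq_one φ).2 fun u hu => ?_, surjective F S⟩
  have hcov := isTriangleCovering F S
  have hbase : S.proj S.base = p := by
    rw [← one_smul U S.base, proj_smul_base, map_one, one_smul]
  have hself : S.base ∈ twoStep (S.Edge adj) S.base := by
    obtain ⟨y, hy⟩ := F.exists_adj
    obtain ⟨b, -, hb⟩ := exists_edge F (S := S) (a := S.base) (by rwa [hbase])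
    exact hcov.self_mem_twoStep hb
  -- the elements of `U` that stabilise the sheet of the covering through the base point
  let N : Subgroup U :=
    { carrier := {v | v • S.base ∈ twoStep (S.Edge adj) S.base}
      one_mem' := by simpa using hself
      mul_mem' := by
        rintro v w hv ⟨c, hc, hcw⟩
        have h1 := hcov.twoStep_closed F.common hv (hc.smul v)
        have h2 := hcov.twoStep_closed F.common h1 (hcw.smul v)
        rwa [smul_smul] at h2
      inv_mem' := by
        rintro v ⟨c, hc, hcv⟩
        have h1 := (Edge.symm F hcv).smul v⁻¹
        rw [inv_smul_smul] at h1
        exact ⟨_, h1, (Edge.symm F hc).smul v⁻¹⟩ }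
  have hN : N = ⊤ := by
    rw [← top_le_iff, ← S.generate]
    refine sup_le (sup_le ?_ ?_) ?_
    · rintro _ ⟨x, rfl⟩
      change S.liftP x • S.base ∈ twoStep _ _
      rwa [liftP_smul_base]
    · rintro _ ⟨k, rfl⟩
      change S.liftL k • S.base ∈ twoStep _ _
      rcases F.line_adj k k.2 with h | h
      · rw [show k = ⟨(k : G), k.2⟩ from rfl, ← S.liftP_eq_liftL k h k.2, liftP_smul_base]
        exact hself
      · refine hcov.mem_twoStep_of_adj F.common ⟨1, k, by rw [one_smul], by rw [one_smul], h⟩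
    · rintro _ ⟨k, rfl⟩
      change S.liftPi k • S.base ∈ twoStep _ _
      obtain ⟨n, hn, d, hd, h1, h2⟩ := F.plane_connected k k.2
      have h1' := edge_plane F (S := S) S.one_mem hd (k := 1) (k' := ⟨n, hn⟩) (by simpa using h1)
      have h2' := edge_plane F (S := S) hd S.one_mem (k := ⟨n, hn⟩) (k' := k) (by simpa using h2)
      have h1l : S.liftL ⟨1, S.mem_stabilizer 1 S.one_mem⟩ = 1 := map_one S.liftL
      rw [h1l, one_smul] at h1' h2'
      rw [map_one, one_smul] at h1'
      exact ⟨_, h1', h2'⟩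
  have huN : u ∈ N := hN ▸ Subgroup.mem_top u
  have h1 : u • S.base = S.base := hcov.injOn_twoStep F.common S.base huN hself
    (by rw [proj_smul, hu, one_smul])
  obtain ⟨x, rfl⟩ := (S.smul_base_eq_iff u).1 h1
  rw [map_liftP] at hu
  rw [show x = 1 from Subtype.ext hu, map_one]

end StabilizerLift

end Amalgam

/-! ### Automorphisms of the split octonions -/

section Octonions

open scoped Matrix

variable {K : Type*} [Field K]

theorem dotProduct_fin_three (u v : Fin 3 → K) : u ⬝ᵥ v = u 0 * v 0 + u 1 * v 1 + u 2 * v 2 := by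
  simp [dotProduct, Fin.sum_univ_three]

theorem crossProduct_zero_apply (u v : Fin 3 → K) :
    crossProduct u v 0 = u 1 * v 2 - u 2 * v 1 := by simp [cross_apply]

theorem crossProduct_one_apply (u v : Fin 3 → K) :
    crossProduct u v 1 = u 2 * v 0 - u 0 * v 2 := by simp [cross_apply]

theorem crossProduct_two_apply (u v : Fin 3 → K) :
    crossProduct u v 2 = u 0 * v 1 - u 1 * v 0 := by simp [cross_apply]

omit [Field K] in
theorem fin_three_ext {u v : Fin 3 → K} (h0 : u 0 = v 0) (h1 : u 1 = v 1) (h2 : u 2 = v 2) :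
    u = v := by
  funext i
  fin_cases i
  exacts [h0, h1, h2]

omit [Field K] in
theorem V6_ext {x y : V6 K} (h0 : x.1 0 = y.1 0) (h1 : x.1 1 = y.1 1) (h2 : x.1 2 = y.1 2)
    (h3 : x.2 0 = y.2 0) (h4 : x.2 1 = y.2 1) (h5 : x.2 2 = y.2 2) : x = y :=
  Prod.ext (fin_three_ext h0 h1 h2) (fin_three_ext h3 h4 h5)

/-- The action of a matrix `A` of determinant one on vector matrices: by `A` on the top right
entries and by the inverse transpose of `A` on the bottom left ones. -/
def slLinear (A : Matrix.SpecialLinearGroup (Fin 3) K) :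
    SplitOctonion K →ₗ[K] SplitOctonion K where
  toFun x := (x.1, x.2.1, A.1 *ᵥ x.2.2.1, x.2.2.2 ᵥ* (A⁻¹).1)
  map_add' x y := by simp [Matrix.mulVec_add, Matrix.add_vecMul]
  map_smul' c x := by simp [Matrix.mulVec_smul, Matrix.smul_vecMul]

theorem slLinear_comp (A B : Matrix.SpecialLinearGroup (Fin 3) K) (x : SplitOctonion K) :
    slLinear A (slLinear B x) = slLinear (A * B) x := by
  simp [slLinear, Matrix.mulVec_mulVec, Matrix.vecMul_vecMul]

theorem slLinear_one (x : SplitOctonion K) : slLinear 1 x = x := by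
  simp [slLinear]

theorem slLinear_mul (A : Matrix.SpecialLinearGroup (Fin 3) K) (x y : SplitOctonion K) :
    slLinear A (zornMul x y) = zornMul (slLinear A x) (slLinear A y) := by
  obtain ⟨a, b, u, v⟩ := x
  obtain ⟨a', b', u', v'⟩ := y
  have hA := A.2
  have hB : (A⁻¹).1 = A.1.adjugate := A.coe_inv
  rw [Matrix.det_fin_three] at hA
  refine Prod.ext ?_ (Prod.ext ?_ (Prod.ext (fin_three_ext ?_ ?_ ?_) (fin_three_ext ?_ ?_ ?_)))
  all_goals
    simp only [slLinear, zornMul, LinearMap.coe_mk, AddHom.coe_mk,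
      hB, Matrix.mulVec, Matrix.vecMul, dotProduct_fin_three,
      Matrix.adjugate_fin_three, crossProduct_zero_apply, crossProduct_one_apply,
      crossProduct_two_apply, Pi.add_apply, Pi.sub_apply, Pi.smul_apply, smul_eq_mul,
      Matrix.of_apply, Matrix.cons_val', Matrix.cons_val_zero, Matrix.cons_val_one,
      Matrix.cons_val, Matrix.empty_val']
    grind

variable [CharP K 2]

/-- The unipotent map attached to `w` in `K ^ 3`; for `w` a multiple of a basis vector it is an
element of a short root group. The signs are those of characteristic two, where this map is an
involution. -/
def lowerLinear (w : Fin 3 → K) : SplitOctonion K →ₗ[K] SplitOctonion K where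
  toFun x := (x.1 + w ⬝ᵥ x.2.2.1, x.2.1 + w ⬝ᵥ x.2.2.1, x.2.2.1 + crossProduct w x.2.2.2,
    x.2.2.2 + (x.1 + x.2.1 + w ⬝ᵥ x.2.2.1) • w)
  map_add' x y := by
    refine Prod.ext ?_ (Prod.ext ?_ (Prod.ext ?_ ?_))
    · simp only [Prod.fst_add, Prod.snd_add, dotProduct_add]; ring
    · simp only [Prod.fst_add, Prod.snd_add, dotProduct_add]; ring
    · simp only [Prod.fst_add, Prod.snd_add, map_add]; abel
    · simp only [Prod.fst_add, Prod.snd_add, dotProduct_add]; module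
  map_smul' c x := by
    refine Prod.ext ?_ (Prod.ext ?_ (Prod.ext ?_ ?_))
    · simp only [Prod.smul_fst, Prod.smul_snd, dotProduct_smul, RingHom.id_apply, smul_eq_mul]; ring
    · simp only [Prod.smul_fst, Prod.smul_snd, dotProduct_smul, RingHom.id_apply, smul_eq_mul]; ring
    · simp only [Prod.smul_fst, Prod.smul_snd, map_smul, RingHom.id_apply, smul_add]
    · simp only [Prod.smul_fst, Prod.smul_snd, dotProduct_smul, RingHom.id_apply, smul_eq_mul]
      module

theorem lowerLinear_involutive (w : Fin 3 → K) : Function.Involutive (lowerLinear w) := by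
  rintro ⟨a, b, u, v⟩
  refine Prod.ext ?_ (Prod.ext ?_ (Prod.ext (fin_three_ext ?_ ?_ ?_) (fin_three_ext ?_ ?_ ?_)))
  all_goals
    simp only [lowerLinear, LinearMap.coe_mk, AddHom.coe_mk, dotProduct_fin_three,
      crossProduct_zero_apply, crossProduct_one_apply, crossProduct_two_apply, Pi.add_apply,
      Pi.smul_apply, smul_eq_mul]
    grind

theorem lowerLinear_mul (w : Fin 3 → K) (x y : SplitOctonion K) :
    lowerLinear w (zornMul x y) = zornMul (lowerLinear w x) (lowerLinear w y) := by
  obtain ⟨a, b, u, v⟩ := x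
  obtain ⟨a', b', u', v'⟩ := y
  refine Prod.ext ?_ (Prod.ext ?_ (Prod.ext (fin_three_ext ?_ ?_ ?_) (fin_three_ext ?_ ?_ ?_)))
  all_goals
    simp only [lowerLinear, zornMul, LinearMap.coe_mk, AddHom.coe_mk, dotProduct_fin_three,
      crossProduct_zero_apply, crossProduct_one_apply, crossProduct_two_apply, Pi.add_apply,
      Pi.sub_apply, Pi.smul_apply, smul_eq_mul]
    grind

/-- Transposition of vector matrices. -/
def swapLinear (K : Type*) [Field K] : SplitOctonion K →ₗ[K] SplitOctonion K where
  toFun x := (x.2.1, x.1, x.2.2.2, x.2.2.1)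
  map_add' _ _ := rfl
  map_smul' _ _ := rfl

theorem swapLinear_mul (x y : SplitOctonion K) :
    swapLinear K (zornMul x y) = zornMul (swapLinear K x) (swapLinear K y) := by
  obtain ⟨a, b, u, v⟩ := x
  obtain ⟨a', b', u', v'⟩ := y
  refine Prod.ext ?_ (Prod.ext ?_ (Prod.ext (fin_three_ext ?_ ?_ ?_) (fin_three_ext ?_ ?_ ?_)))
  all_goals
    simp only [swapLinear, zornMul, LinearMap.coe_mk, AddHom.coe_mk, dotProduct_fin_three,
      crossProduct_zero_apply, crossProduct_one_apply, crossProduct_two_apply, Pi.add_apply,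
      Pi.sub_apply, Pi.smul_apply, smul_eq_mul]
  all_goals grind

/-- The automorphism given by an involutive multiplicative linear map. -/
def involutionG2 (f : SplitOctonion K →ₗ[K] SplitOctonion K) (hf : Function.Involutive f)
    (hmul : ∀ x y, f (zornMul x y) = zornMul (f x) (f y)) : G2 K :=
  ⟨LinearEquiv.ofInvolutive f hf, hmul⟩

/-- The embedding of `SL₃(K)` in `G₂(K)`. -/
def slG2 (A : Matrix.SpecialLinearGroup (Fin 3) K) : G2 K :=
  ⟨LinearEquiv.ofLinearMap (slLinear A) (slLinear A⁻¹)
    (LinearMap.ext fun x => by simp [slLinear_comp, slLinear_one])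
    (LinearMap.ext fun x => by simp [slLinear_comp, slLinear_one]), slLinear_mul A⟩

/-- The automorphism `lowerLinear w`. -/
def lowerG2 (w : Fin 3 → K) : G2 K :=
  involutionG2 (lowerLinear w) (lowerLinear_involutive w) (lowerLinear_mul w)

/-- The automorphism `swapLinear K`, which is multiplicative in characteristic two only. -/
def swapG2 (K : Type*) [Field K] [CharP K 2] : G2 K :=
  involutionG2 (swapLinear K) (fun _ => rfl) swapLinear_mul

/-- The conjugate of `lowerG2 w` under `swapG2 K`. -/
def upperG2 (w : Fin 3 → K) : G2 K := swapG2 K * lowerG2 w * swapG2 K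

theorem rep6_slG2 (A : Matrix.SpecialLinearGroup (Fin 3) K) (x : V6 K) :
    rep6 K (slG2 A) x = (A.1 *ᵥ x.1, x.2 ᵥ* (A⁻¹).1) := rfl

theorem rep6_swapG2 (x : V6 K) : rep6 K (swapG2 K) x = (x.2, x.1) := rfl

theorem rep6_lowerG2 (w : Fin 3 → K) (x : V6 K) :
    rep6 K (lowerG2 w) x = (x.1 + crossProduct w x.2, x.2 + (w ⬝ᵥ x.1) • w) := by
  change ((x.1 + crossProduct w x.2, x.2 + (0 + 0 + w ⬝ᵥ x.1) • w) : V6 K) = _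
  rw [add_zero, zero_add]

theorem rep6_upperG2 (w : Fin 3 → K) (x : V6 K) :
    rep6 K (upperG2 w) x = (x.1 + (w ⬝ᵥ x.2) • w, x.2 + crossProduct w x.1) := by
  rw [upperG2, map_mul, map_mul, Module.End.mul_apply, Module.End.mul_apply, rep6_swapG2,
    rep6_lowerG2, rep6_swapG2]

theorem inclV6_map (g : G2 K) (x : V6 K) :
    ∃ c : K, g.1 (inclV6 K x) = inclV6 K (rep6 K g x) + c • ((1, 1, 0, 0) : SplitOctonion K) := by
  refine ⟨(g.1 (inclV6 K x)).1, Prod.ext ?_ (Prod.ext ?_ ?_)⟩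
  · simp [inclV6]
  · simpa [inclV6] using (octonionAut_trace_zero g x).symm
  · simp [inclV6, rep6, projV6]

/-- The symplectic form is invariant: it is the anticommutator of trace-zero octonions. -/
theorem sympForm_rep6 (g : G2 K) (x y : V6 K) :
    sympForm (rep6 K g x) (rep6 K g y) = sympForm x y := by
  have anti : ∀ (x y : V6 K) (c d : K),
      zornMul (inclV6 K x + c • ((1, 1, 0, 0) : SplitOctonion K)) (inclV6 K y + d • (1, 1, 0, 0)) +
      zornMul (inclV6 K y + d • ((1, 1, 0, 0) : SplitOctonion K)) (inclV6 K x + c • (1, 1, 0, 0)) =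
      sympForm x y • ((1, 1, 0, 0) : SplitOctonion K) := by
    intro x y c d
    refine Prod.ext ?_ (Prod.ext ?_ (Prod.ext (fin_three_ext ?_ ?_ ?_) (fin_three_ext ?_ ?_ ?_)))
    all_goals
      simp [inclV6, zornMul, sympForm, dotProduct_fin_three, crossProduct_zero_apply,
        crossProduct_one_apply, crossProduct_two_apply]
      grind
  have h0 : ∀ x : V6 K, inclV6 K x = inclV6 K x + (0 : K) • ((1, 1, 0, 0) : SplitOctonion K) := by
    simp
  obtain ⟨c, hc⟩ := inclV6_map g x
  obtain ⟨d, hd⟩ := inclV6_map g y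
  have h := anti (rep6 K g x) (rep6 K g y) c d
  rw [← hc, ← hd, ← g.2, ← g.2, ← map_add, h0 x, h0 y, anti, map_smul, octonionAut_map_one] at h
  simpa using (congrArg Prod.fst h).symm

end Octonions

/-! ### Normal forms of vectors and hyperbolic pairs -/

section Representation

open scoped Matrix

variable {K : Type*} [Field K]

/-- The basis vector with `X₀ = 1`. -/
def E0 (K : Type*) [Field K] : V6 K := (![1, 0, 0], ![0, 0, 0])

/-- The basis vector with `X₄ = 1`; it spans a hyperbolic line with `E0 K`. -/
def E4 (K : Type*) [Field K] : V6 K := (![0, 0, 0], ![1, 0, 0])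

/-- The basis vector with `X₁ = 1`. -/
def E1 (K : Type*) [Field K] : V6 K := (![0, 1, 0], ![0, 0, 0])

/-- The vector with `X₀ = X₄ = 0` and the given other coordinates: a vector orthogonal to `E0 K`
and `E4 K`. -/
def perpVec (a b c d : K) : V6 K := (![0, a, b], ![0, c, d])

variable [CharP K 2]

theorem upperG2_zero_E0 (t : K) : rep6 K (upperG2 ![t, 0, 0]) (E0 K) = E0 K := by
  rw [rep6_upperG2]
  apply V6_ext <;> simp [E0, crossProduct_zero_apply, crossProduct_one_apply,
    crossProduct_two_apply, dotProduct_fin_three,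
      -Matrix.cons_dotProduct, -Matrix.dotProduct_cons]

omit [CharP K 2] in
theorem exists_sl_mulVec {u : Fin 3 → K} (hu : u ≠ 0) :
    ∃ A : Matrix.SpecialLinearGroup (Fin 3) K, A.1 *ᵥ u = ![1, 0, 0] := by
  by_cases h0 : u 0 = 0
  · by_cases h1 : u 1 = 0
    · have h2 : u 2 ≠ 0 := fun h2 => hu (fin_three_ext h0 h1 h2)
      refine ⟨⟨!![0, 0, (u 2)⁻¹; u 2, 0, 0; 0, 1, 0], ?_⟩, ?_⟩
      · simp [Matrix.det_fin_three, h2]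
      · apply fin_three_ext <;> simp [Matrix.mulVec, dotProduct_fin_three,
      -Matrix.cons_dotProduct, -Matrix.dotProduct_cons, h0, h1, h2]
    · refine ⟨⟨!![0, (u 1)⁻¹, 0; 0, -u 2 / u 1, 1; u 1, 0, 0], ?_⟩, ?_⟩
      · simp [Matrix.det_fin_three, h1]
      · apply fin_three_ext <;> simp [Matrix.mulVec, dotProduct_fin_three,
      -Matrix.cons_dotProduct, -Matrix.dotProduct_cons, h0, h1]
  · refine ⟨⟨!![(u 0)⁻¹, 0, 0; -u 1, u 0, 0; -u 2 / u 0, 0, 1], ?_⟩, ?_⟩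
    · simp [Matrix.det_fin_three, h0]
    · apply fin_three_ext <;> simp [Matrix.mulVec, dotProduct_fin_three,
      -Matrix.cons_dotProduct, -Matrix.dotProduct_cons, h0]
      ring

theorem exists_rep6_eq_mulVec (A : Matrix (Fin 3) (Fin 3) K) (hA : A.det = 1) :
    ∃ g : G2 K, ∀ x, rep6 K g x = (A *ᵥ x.1, x.2 ᵥ* A.adjugate) := by
  obtain ⟨A, rfl⟩ : ∃ B : Matrix.SpecialLinearGroup (Fin 3) K, B.1 = A := ⟨⟨A, hA⟩, rfl⟩
  exact ⟨slG2 A, fun x => by rw [rep6_slG2, Matrix.SpecialLinearGroup.coe_inv]⟩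

/-- `G₂(K)` is transitive on nonzero vectors. -/
theorem exists_rep6_eq_E0 (hK : Function.Surjective (fun x : K => x ^ 2)) {x : V6 K}
    (hx : x ≠ 0) : ∃ g : G2 K, rep6 K g x = E0 K := by
  have key : ∀ x : V6 K, x.1 ≠ 0 → ∃ g : G2 K, rep6 K g x = E0 K := by
    intro x hx
    obtain ⟨A, hA⟩ := exists_sl_mulVec hx
    obtain ⟨v, hv⟩ : ∃ v, rep6 K (slG2 A) x = (![1, 0, 0], v) := ⟨_, by rw [rep6_slG2, hA]⟩
    obtain ⟨t, ht⟩ := hK (v 0)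
    have h1 : rep6 K (upperG2 ![0, v 2, v 1]) (![1, 0, 0], v) = (![1, 0, 0], ![v 0, 0, 0]) := by
      rw [rep6_upperG2]
      apply V6_ext <;> simp [crossProduct_zero_apply, crossProduct_one_apply,
        crossProduct_two_apply, dotProduct_fin_three,
      -Matrix.cons_dotProduct, -Matrix.dotProduct_cons] <;> grind
    have h2 : rep6 K (lowerG2 ![t, 0, 0]) (![1, 0, 0], ![v 0, 0, 0]) = E0 K := by
      rw [rep6_lowerG2]
      apply V6_ext <;> simp [E0, crossProduct_zero_apply, crossProduct_one_apply,
        crossProduct_two_apply, dotProduct_fin_three,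
      -Matrix.cons_dotProduct, -Matrix.dotProduct_cons]
      grind
    exact ⟨lowerG2 ![t, 0, 0] * upperG2 ![0, v 2, v 1] * slG2 A, by
      rw [map_mul, map_mul, Module.End.mul_apply, Module.End.mul_apply, hv, h1, h2]⟩
  by_cases h : x.1 = 0
  · obtain ⟨g, hg⟩ := key (x.2, x.1) fun h' => hx (Prod.ext h h')
    exact ⟨g * swapG2 K, by rw [map_mul, Module.End.mul_apply, rep6_swapG2, hg]⟩
  · exact key x h

/-- `G₂(K)` is transitive on hyperbolic pairs. -/
theorem exists_rep6_eq_E0_E4 (hK : Function.Surjective (fun x : K => x ^ 2)) {x y : V6 K}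
    (hxy : sympForm x y = 1) : ∃ g : G2 K, rep6 K g x = E0 K ∧ rep6 K g y = E4 K := by
  have hx : x ≠ 0 := by
    rintro rfl
    simp [sympForm] at hxy
  obtain ⟨g, hg⟩ := exists_rep6_eq_E0 hK hx
  obtain ⟨u, v, huv⟩ : ∃ u v, rep6 K g y = (u, v) := ⟨_, _, rfl⟩
  have hv : v 0 = 1 := by
    rw [← sympForm_rep6 g, hg, huv] at hxy
    simpa [sympForm, E0, dotProduct_fin_three,
      -Matrix.cons_dotProduct, -Matrix.dotProduct_cons] using hxy
  let A : Matrix.SpecialLinearGroup (Fin 3) K :=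
    ⟨!![1, v 1, v 2; 0, 1, 0; 0, 0, 1], by simp [Matrix.det_fin_three]⟩
  have hA : (A⁻¹).1 = !![1, - v 1, - v 2; 0, 1, 0; 0, 0, 1] := by
    rw [Matrix.SpecialLinearGroup.coe_inv, Matrix.adjugate_fin_three]
    simp [A]
  have hA0 : rep6 K (slG2 A) (E0 K) = E0 K := by
    rw [rep6_slG2, hA]
    apply V6_ext <;> simp [E0, A, Matrix.mulVec, Matrix.vecMul, dotProduct_fin_three,
      -Matrix.cons_dotProduct, -Matrix.dotProduct_cons]
  obtain ⟨w, hw⟩ : ∃ w, rep6 K (slG2 A) (u, v) = (w, ![1, 0, 0]) := by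
    refine ⟨_, Prod.ext rfl ?_⟩
    rw [rep6_slG2, hA]
    apply fin_three_ext <;> simp [Matrix.vecMul, dotProduct_fin_three,
      -Matrix.cons_dotProduct, -Matrix.dotProduct_cons, hv]
  have h10 : rep6 K (lowerG2 ![0, w 2, w 1]) (E0 K) = E0 K := by
    rw [rep6_lowerG2]
    apply V6_ext <;> simp [E0, crossProduct_zero_apply, crossProduct_one_apply,
      crossProduct_two_apply, dotProduct_fin_three,
      -Matrix.cons_dotProduct, -Matrix.dotProduct_cons]
  have h1 : rep6 K (lowerG2 ![0, w 2, w 1]) (w, ![1, 0, 0]) = (![w 0, 0, 0], ![1, 0, 0]) := by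
    rw [rep6_lowerG2]
    apply V6_ext <;> simp [crossProduct_zero_apply, crossProduct_one_apply,
      crossProduct_two_apply, dotProduct_fin_three,
      -Matrix.cons_dotProduct, -Matrix.dotProduct_cons] <;> grind
  obtain ⟨t, ht⟩ := hK (w 0)
  have h2 : rep6 K (upperG2 ![t, 0, 0]) (![w 0, 0, 0], ![1, 0, 0]) = E4 K := by
    rw [rep6_upperG2]
    apply V6_ext <;> simp [E4, crossProduct_zero_apply, crossProduct_one_apply,
      crossProduct_two_apply, dotProduct_fin_three,
      -Matrix.cons_dotProduct, -Matrix.dotProduct_cons]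
    grind
  refine ⟨upperG2 ![t, 0, 0] * lowerG2 ![0, w 2, w 1] * slG2 A * g, ?_, ?_⟩ <;>
    simp only [map_mul, Module.End.mul_apply]
  · rw [hg, hA0, h10, upperG2_zero_E0]
  · rw [huv, hw, h1, h2]

/-- A nonzero singular vector orthogonal to `E0 K` and `E4 K` can be moved to `E1 K` by an element
that stabilises the line spanned by `E0 K` and `E4 K`. -/
theorem exists_rep6_perpVec_eq_E1 {a b c d : K} (hne : perpVec a b c d ≠ 0)
    (hq : a * c + b * d = 0) : ∃ g : G2 K, rep6 K g (perpVec a b c d) = E1 K ∧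
      rep6 K g (E0 K) ∈ Submodule.span K {E0 K, E4 K} ∧
      rep6 K g (E4 K) ∈ Submodule.span K {E0 K, E4 K} := by
  have key : ∀ a b c d : K, (a ≠ 0 ∨ b ≠ 0) → a * c + b * d = 0 →
      ∃ g : G2 K, rep6 K g (perpVec a b c d) = E1 K ∧ rep6 K g (E0 K) = E0 K ∧
        rep6 K g (E4 K) ∈ Submodule.span K {E0 K, E4 K} := by
    intro a b c d hab hq
    obtain ⟨g, t, hg, hg0, hg4⟩ : ∃ (g : G2 K) (t : K),
        rep6 K g (perpVec a b c d) = perpVec 1 0 0 t ∧ rep6 K g (E0 K) = E0 K ∧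
        rep6 K g (E4 K) = E4 K := by
      by_cases ha : a = 0
      · have hb : b ≠ 0 := hab.resolve_left fun h => h ha
        have hd : d = 0 := by simpa [ha, hb] using hq
        obtain ⟨g, hg⟩ := exists_rep6_eq_mulVec !![1, 0, 0; 0, 0, b⁻¹; 0, -b, 0]
          (by simp [Matrix.det_fin_three, hb])
        refine ⟨g, -c / b, ?_, ?_, ?_⟩ <;> rw [hg, Matrix.adjugate_fin_three] <;> apply V6_ext <;>
          simp [perpVec, E0, E4, Matrix.mulVec, Matrix.vecMul, ha, hb, hd, dotProduct_fin_three,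
            -Matrix.cons_dotProduct, -Matrix.dotProduct_cons]
        field_simp
      · obtain ⟨g, hg⟩ := exists_rep6_eq_mulVec !![1, 0, 0; 0, a⁻¹, 0; 0, -b, a]
          (by simp [Matrix.det_fin_three, ha])
        refine ⟨g, d / a, ?_, ?_, ?_⟩ <;> rw [hg, Matrix.adjugate_fin_three] <;> apply V6_ext <;>
          simp [perpVec, E0, E4, Matrix.mulVec, Matrix.vecMul, ha, dotProduct_fin_three,
            -Matrix.cons_dotProduct, -Matrix.dotProduct_cons]
        · ring
        · linear_combination hq
        · field_simp
    refine ⟨upperG2 ![t, 0, 0] * g, ?_, ?_, ?_⟩ <;> rw [map_mul, Module.End.mul_apply]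
    · rw [hg, rep6_upperG2]
      apply V6_ext <;> simp [perpVec, E1, crossProduct_zero_apply, crossProduct_one_apply,
        crossProduct_two_apply, dotProduct_fin_three,
      -Matrix.cons_dotProduct, -Matrix.dotProduct_cons]
      grind
    · rw [hg0, upperG2_zero_E0]
    · rw [hg4, Submodule.mem_span_pair]
      refine ⟨t ^ 2, 1, ?_⟩
      rw [rep6_upperG2]
      apply V6_ext <;> simp [E0, E4, crossProduct_zero_apply, crossProduct_one_apply,
        crossProduct_two_apply, dotProduct_fin_three,
      -Matrix.cons_dotProduct, -Matrix.dotProduct_cons]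
      ring
  by_cases h : a ≠ 0 ∨ b ≠ 0
  · obtain ⟨g, h1, h2, h3⟩ := key a b c d h hq
    exact ⟨g, h1, by rw [h2]; exact Submodule.subset_span (by simp), h3⟩
  · push Not at h
    have hcd : c ≠ 0 ∨ d ≠ 0 := by
      by_contra hcon
      push Not at hcon
      apply hne
      rw [h.1, h.2, hcon.1, hcon.2]
      apply V6_ext <;> simp [perpVec]
    obtain ⟨g, h1, h2, h3⟩ := key c d a b hcd (by linear_combination hq)
    refine ⟨g * swapG2 K, ?_, ?_, ?_⟩ <;> rw [map_mul, Module.End.mul_apply, rep6_swapG2]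
    · exact h1
    · exact h3
    · change rep6 K g (E0 K) ∈ _
      rw [h2]
      exact Submodule.subset_span (by simp)

end Representation

/-! ### Hexagon lines and special planes -/

section HexagonLines

open scoped Matrix

variable {K : Type*} [Field K]

/-- A two-dimensional space of trace-zero octonions of square zero on which all products are
scalar. These are the hexagon lines, in terms of the octonion algebra; in fact the products
vanish. -/
def IsNullPlane (H : Submodule K (SplitOctonion K)) : Prop :=
  Module.finrank K H = 2 ∧ (∀ X ∈ H, X.1 = X.2.1 ∧ zornMul X X = 0) ∧
    ∀ X ∈ H, ∀ Y ∈ H, ∃ c : K, zornMul X Y = c • ((1, 1, 0, 0) : SplitOctonion K)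

/-- The trace-zero octonion with the given coordinates. -/
def octonionOfCoord (K : Type*) [Field K] : (Fin 7 → K) →ₗ[K] SplitOctonion K where
  toFun X := (X 3, X 3, ![X 0, X 1, X 2], ![X 4, X 5, X 6])
  map_add' X Y := by
    refine Prod.ext rfl (Prod.ext rfl (Prod.ext ?_ ?_)) <;> apply fin_three_ext <;> simp
  map_smul' c X := by
    refine Prod.ext rfl (Prod.ext rfl (Prod.ext ?_ ?_)) <;> apply fin_three_ext <;> simp

theorem octonionOfCoord_injective : Function.Injective (octonionOfCoord K) := by
  rw [injective_iff_map_eq_zero]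
  intro X hX
  have h3 : X 3 = 0 := congrArg (fun z => z.1) hX
  have h0 : X 0 = 0 := congrArg (fun z => z.2.2.1 0) hX
  have h1 : X 1 = 0 := congrArg (fun z => z.2.2.1 1) hX
  have h2 : X 2 = 0 := congrArg (fun z => z.2.2.1 2) hX
  have h4 : X 4 = 0 := congrArg (fun z => z.2.2.2 0) hX
  have h5 : X 5 = 0 := congrArg (fun z => z.2.2.2 1) hX
  have h6 : X 6 = 0 := congrArg (fun z => z.2.2.2 2) hX
  funext i
  fin_cases i
  exacts [h0, h1, h2, h3, h4, h5, h6]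

theorem IsNullPlane.map {H : Submodule K (SplitOctonion K)} [CharP K 2] (hH : IsNullPlane H)
    (g : G2 K) : IsNullPlane (H.map (g.1 : SplitOctonion K →ₗ[K] SplitOctonion K)) := by
  obtain ⟨h1, h2, h3⟩ := hH
  refine ⟨by rw [← h1]; exact LinearEquiv.finrank_map_eq g.1 H, ?_, ?_⟩
  · rintro _ ⟨X, hX, rfl⟩
    obtain ⟨htr, hsq⟩ := h2 X hX
    have hX' : X = inclV6 K (projV6 K X) + X.1 • ((1, 1, 0, 0) : SplitOctonion K) := by
      refine Prod.ext ?_ (Prod.ext ?_ ?_) <;> simp [inclV6, projV6, htr]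
    constructor
    · have := octonionAut_trace_zero g (projV6 K X)
      change (g.1 X).1 = (g.1 X).2.1
      rw [hX', map_add, map_smul, octonionAut_map_one]
      simpa using this
    · change zornMul (g.1 X) (g.1 X) = 0
      rw [← g.2, hsq, map_zero]
  · rintro _ ⟨X, hX, rfl⟩ _ ⟨Y, hY, rfl⟩
    obtain ⟨c, hc⟩ := h3 X hX Y hY
    refine ⟨c, ?_⟩
    change zornMul (g.1 X) (g.1 Y) = _
    rw [← g.2, hc, map_smul, octonionAut_map_one]

theorem IsHexagonLine.exists_isNullPlane [CharP K 2] {h : Submodule K (V6 K)}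
    (hh : IsHexagonLine h) : ∃ H, IsNullPlane H ∧ H.map (projV6 K) = h := by
  obtain ⟨L, ⟨h2, hq, hg⟩, rfl⟩ := hh
  refine ⟨L.map (octonionOfCoord K), ⟨?_, ?_, ?_⟩, ?_⟩
  · rw [← h2]
    exact (Submodule.equivMapOfInjective _ octonionOfCoord_injective L).finrank_eq.symm
  · rintro _ ⟨X, hX, rfl⟩
    refine ⟨rfl, ?_⟩
    have := hq X hX
    refine Prod.ext ?_ (Prod.ext ?_ (Prod.ext (fin_three_ext ?_ ?_ ?_) (fin_three_ext ?_ ?_ ?_)))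
    all_goals
      simp [octonionOfCoord, zornMul, dotProduct_fin_three, -Matrix.cons_dotProduct,
        -Matrix.dotProduct_cons]
      grind
  · rintro _ ⟨X, hX, rfl⟩ _ ⟨Y, hY, rfl⟩
    have hX' := hq X hX
    have hY' := hq Y hY
    have hXY := hq (X + Y) (L.add_mem hX hY)
    obtain ⟨g1, g2, g3, g4, g5, g6⟩ := hg X hX Y hY
    simp only [grassmann, Pi.add_apply] at g1 g2 g3 g4 g5 g6 hXY
    refine ⟨X 3 * Y 3 + (X 0 * Y 4 + X 1 * Y 5 + X 2 * Y 6), ?_⟩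
    refine Prod.ext ?_ (Prod.ext ?_ (Prod.ext (fin_three_ext ?_ ?_ ?_) (fin_three_ext ?_ ?_ ?_)))
    all_goals
      simp [octonionOfCoord, zornMul, dotProduct_fin_three, cross_apply, -Matrix.cons_dotProduct,
        -Matrix.dotProduct_cons]
    all_goals grind
  · rw [← Submodule.map_comp]
    rfl

theorem IsNullPlane.exists_basis {H : Submodule K (SplitOctonion K)} (hH : IsNullPlane H) :
    ∃ X ∈ H, ∃ Y ∈ H, ∀ s t : K, s • X + t • Y = 0 → s = 0 ∧ t = 0 := by
  let B := Module.finBasisOfFinrankEq K H hH.1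
  refine ⟨B 0, (B 0).2, B 1, (B 1).2, LinearIndependent.pair_iff.1 ?_⟩
  convert B.linearIndependent.map' H.subtype H.ker_subtype using 1
  funext i
  fin_cases i <;> rfl

/-- A hexagon line is not the nonisotropic line spanned by `E0 K` and `E4 K`. -/
theorem IsNullPlane.not_le_line [CharP K 2] {H : Submodule K (SplitOctonion K)}
    (hH : IsNullPlane H) : ¬ H.map (projV6 K) ≤ Submodule.span K {E0 K, E4 K} := by
  intro hle
  have coord : ∀ X ∈ H, ∃ x α β : K, X = (x, x, ![α, 0, 0], ![β, 0, 0]) := by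
    intro X hX
    obtain ⟨hx, -⟩ := hH.2.1 X hX
    obtain ⟨α, β, h⟩ := Submodule.mem_span_pair.1 (hle ⟨X, hX, rfl⟩)
    obtain ⟨x, y, u, v⟩ := X
    obtain rfl : x = y := hx
    change _ = (u, v) at h
    obtain ⟨rfl, rfl⟩ := Prod.ext_iff.1 h
    refine ⟨x, α, β, ?_⟩
    refine Prod.ext rfl (Prod.ext rfl (Prod.ext ?_ ?_)) <;> apply fin_three_ext <;> simp [E0, E4]
  obtain ⟨X, hX, Y, hY, hli⟩ := hH.exists_basis
  obtain ⟨k, hk⟩ := hH.2.2 X hX Y hY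
  have q1 := congrArg Prod.fst (hH.2.1 X hX).2
  have q2 := congrArg Prod.fst (hH.2.1 Y hY).2
  have q3 := congrArg Prod.fst (hH.2.1 _ (H.add_mem hX hY)).2
  obtain ⟨x, α, β, rfl⟩ := coord X hX
  obtain ⟨x', α', β', rfl⟩ := coord Y hY
  have e1 := congrArg (fun z => z.2.2.1 0) hk
  have e2 := congrArg (fun z => z.2.2.2 0) hk
  simp [zornMul, dotProduct_fin_three, cross_apply, -Matrix.cons_dotProduct,
    -Matrix.dotProduct_cons] at e1 e2 q1 q2 q3
  clear hle coord hk
  have zero : ∀ s t : K, s * x + t * x' = 0 → s * α + t * α' = 0 → s * β + t * β' = 0 →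
      s = 0 ∧ t = 0 := by
    intro s t h1 h2 h3
    apply hli
    refine Prod.ext ?_ (Prod.ext ?_ (Prod.ext (fin_three_ext ?_ ?_ ?_)
      (fin_three_ext ?_ ?_ ?_))) <;> simp [h1, h2, h3]
  obtain ⟨rfl, rfl⟩ := zero x' x (by grind) (by grind) (by grind)
  obtain ⟨rfl, rfl⟩ := zero α' α (by grind) (by grind) (by grind)
  obtain ⟨rfl, rfl⟩ := zero β' β (by grind) (by grind) (by grind)
  exact one_ne_zero (zero 1 0 (by simp) (by simp) (by simp)).1

/-- If the plane spanned by `E0 K`, `E4 K` and `(0, a, b; 0, c, d)` contains a hexagon line, then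
that vector is singular. -/
theorem IsNullPlane.singular [CharP K 2] {H : Submodule K (SplitOctonion K)} (hH : IsNullPlane H)
    {a b c d : K}
    (hle : H.map (projV6 K) ≤ Submodule.span K {E0 K, E4 K, perpVec a b c d}) :
    a * c + b * d = 0 := by
  obtain ⟨h2, h3, h4⟩ := id hH
  have coord : ∀ X ∈ H, ∃ x α β γ : K, X = (x, x, ![α, γ * a, γ * b], ![β, γ * c, γ * d]) := by
    intro X hX
    obtain ⟨hx, -⟩ := h3 X hX
    obtain ⟨α, β, γ, h⟩ := Submodule.mem_span_triple.1 (hle ⟨X, hX, rfl⟩)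
    obtain ⟨x, y, u, v⟩ := X
    obtain rfl : x = y := hx
    change _ = (u, v) at h
    obtain ⟨rfl, rfl⟩ := Prod.ext_iff.1 h
    refine ⟨x, α, β, γ, ?_⟩
    refine Prod.ext rfl (Prod.ext rfl (Prod.ext ?_ ?_)) <;> apply fin_three_ext <;>
      simp [E0, E4, perpVec]
  by_contra hq
  -- No nonzero vector of `H` lies above the line spanned by `E0 K` and `E4 K`.
  have main : ∀ X ∈ H, ∀ Y ∈ H, ∀ x α β y α' β' γ' : K, X = (x, x, ![α, 0, 0], ![β, 0, 0]) →
      Y = (y, y, ![α', γ' * a, γ' * b], ![β', γ' * c, γ' * d]) → γ' ≠ 0 → X = 0 := by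
    intro X hX Y hY x α β y α' β' γ' hX' hY' hγ
    obtain ⟨k, hk⟩ := h4 X hX Y hY
    have hsq := congrArg Prod.fst (h3 X hX).2
    have e1 := congrArg (fun z => z.2.2.1 1) hk
    have e2 := congrArg (fun z => z.2.2.1 2) hk
    have e3 := congrArg (fun z => z.2.2.2 1) hk
    have e4 := congrArg (fun z => z.2.2.2 2) hk
    simp [hX', hY', zornMul, dotProduct_fin_three, cross_apply, -Matrix.cons_dotProduct,
      -Matrix.dotProduct_cons] at hsq e1 e2 e3 e4
    have hx : x = 0 := by
      by_contra hx
      grind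
    have hα : α = 0 := by
      by_contra hα
      grind
    have hβ : β = 0 := by
      by_contra hβ
      grind
    rw [hX', hx, hα, hβ]
    simp
  refine hH.not_le_line ?_
  rintro _ ⟨X, hX, rfl⟩
  obtain ⟨Y, hY, y, α', β', γ', hY', hγ'⟩ | hall :
      (∃ Y ∈ H, ∃ y α' β' γ' : K, Y = (y, y, ![α', γ' * a, γ' * b], ![β', γ' * c, γ' * d]) ∧
        γ' ≠ 0) ∨ ∀ X ∈ H, ∃ x α β : K, X = (x, x, ![α, 0, 0], ![β, 0, 0]) := by
    by_contra! hcon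
    obtain ⟨Z, hZ, hZ'⟩ := hcon.2
    obtain ⟨x, α, β, γ, hZ''⟩ := coord Z hZ
    have hγ := hcon.1 Z hZ x α β γ hZ''
    exact hZ' x α β (by simpa [hγ] using hZ'')
  · -- Otherwise two vectors of `H` have a nonzero combination above that line.
    exfalso
    obtain ⟨X, hX, Z, hZ, hli⟩ := hH.exists_basis
    have comb : ∀ X ∈ H, ∃ s : K, X = s • Y := by
      intro X hX
      obtain ⟨x, α, β, γ, hX'⟩ := coord X hX
      refine ⟨γ / γ', sub_eq_zero.1 (main _ (H.sub_mem hX (H.smul_mem _ hY)) _ hY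
        (x - γ / γ' * y) (α - γ / γ' * α') (β - γ / γ' * β') y α' β' γ' ?_ hY' hγ')⟩
      rw [hX', hY']
      refine Prod.ext ?_ (Prod.ext ?_ (Prod.ext (fin_three_ext ?_ ?_ ?_)
          (fin_three_ext ?_ ?_ ?_))) <;> simp <;> field_simp <;> simp
    obtain ⟨s, rfl⟩ := comb X hX
    obtain ⟨t, rfl⟩ := comb Z hZ
    obtain ⟨rfl, hs⟩ := hli t (-s) (by module)
    exact one_ne_zero (hli 0 1 (by simp)).2
  · obtain ⟨x, α, β, rfl⟩ := hall X hX
    refine Submodule.mem_span_pair.2 ⟨α, β, ?_⟩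
    apply V6_ext <;> simp [E0, E4, projV6]

end HexagonLines

/-! ### The graph of non-orthogonal points -/

section Geometry

open scoped Matrix

variable {K : Type*} [Field K]

/-- Two points are adjacent if they are not orthogonal; spanning vectors can then be chosen to form
a hyperbolic pair. -/
def NonPerp (x y : Submodule K (V6 K)) : Prop :=
  ∃ a b : V6 K, x = K ∙ a ∧ y = K ∙ b ∧ sympForm a b = 1

theorem sympForm_add_left (x y z : V6 K) : sympForm (x + y) z = sympForm x z + sympForm y z := by
  simp only [sympForm, Prod.fst_add, Prod.snd_add, add_dotProduct]
  ring

theorem sympForm_smul_left (c : K) (x z : V6 K) : sympForm (c • x) z = c * sympForm x z := by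
  simp only [sympForm, Prod.smul_fst, Prod.smul_snd, smul_dotProduct, smul_eq_mul]
  ring

theorem sympForm_comm (x y : V6 K) : sympForm x y = sympForm y x := by
  simp only [sympForm, dotProduct_comm y.1, dotProduct_comm y.2]
  ring

theorem sympForm_add_right (x y z : V6 K) : sympForm x (y + z) = sympForm x y + sympForm x z := by
  rw [sympForm_comm, sympForm_add_left, sympForm_comm y, sympForm_comm z]

theorem sympForm_smul_right (c : K) (x z : V6 K) : sympForm x (c • z) = c * sympForm x z := by
  rw [sympForm_comm, sympForm_smul_left, sympForm_comm]

theorem sympForm_zero_left (z : V6 K) : sympForm 0 z = 0 := by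
  simp [sympForm]

theorem sympForm_self [CharP K 2] (x : V6 K) : sympForm x x = 0 := by
  rw [sympForm, dotProduct_comm x.2, CharTwo.add_self_eq_zero]

theorem NonPerp.symm {x y : Submodule K (V6 K)} (h : NonPerp x y) : NonPerp y x := by
  obtain ⟨a, b, rfl, rfl, h⟩ := h
  exact ⟨b, a, rfl, rfl, by rw [sympForm_comm, h]⟩

theorem nonPerp_span_iff {a b : V6 K} :
    NonPerp (K ∙ a) (K ∙ b) ↔ sympForm a b ≠ 0 := by
  constructor
  · rintro ⟨a', b', ha, hb, h⟩ hab
    obtain ⟨s, rfl⟩ := Submodule.mem_span_singleton.1 (ha ▸ Submodule.mem_span_singleton_self a')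
    obtain ⟨t, rfl⟩ := Submodule.mem_span_singleton.1 (hb ▸ Submodule.mem_span_singleton_self b')
    rw [sympForm_smul_left, sympForm_smul_right, hab] at h
    simp at h
  · intro h
    refine ⟨a, (sympForm a b)⁻¹ • b, rfl, ?_, ?_⟩
    · exact (Submodule.span_singleton_smul_eq (isUnit_iff_ne_zero.2 (inv_ne_zero h)) b).symm
    · rw [sympForm_smul_right, inv_mul_cancel₀ h]

theorem isPoint_iff {x : Submodule K (V6 K)} : IsPoint x ↔ ∃ a : V6 K, a ≠ 0 ∧ x = K ∙ a := by
  constructor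
  · intro h
    obtain ⟨⟨a, ha⟩, hne, hspan⟩ := finrank_eq_one_iff'.1 h
    refine ⟨a, fun h0 => hne (Subtype.ext h0), le_antisymm ?_ ?_⟩
    · intro b hb
      obtain ⟨c, hc⟩ := hspan ⟨b, hb⟩
      exact Submodule.mem_span_singleton.2 ⟨c, congrArg Subtype.val hc⟩
    · rwa [Submodule.span_singleton_le_iff_mem]
  · rintro ⟨a, ha, rfl⟩
    exact finrank_span_singleton ha

theorem span_eq_span_of_mem {a b : V6 K} (ha : a ≠ 0) (h : a ∈ K ∙ b) : (K ∙ a) = K ∙ b := by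
  obtain ⟨c, rfl⟩ := Submodule.mem_span_singleton.1 h
  have hc : c ≠ 0 := by
    rintro rfl
    simp at ha
  exact Submodule.span_singleton_smul_eq (isUnit_iff_ne_zero.2 hc) b

theorem ne_zero_of_sympForm {a b : V6 K} (h : sympForm a b ≠ 0) : a ≠ 0 := by
  rintro rfl
  exact h (sympForm_zero_left b)

/-- Nondegeneracy of the symplectic form: its values on independent vectors can be prescribed. -/
theorem exists_sympForm_eq {n : ℕ} {v : Fin n → V6 K} (hv : LinearIndependent K v)
    (c : Fin n → K) : ∃ w : V6 K, ∀ i, sympForm (v i) w = c i := by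
  obtain ⟨f, hf⟩ := LinearMap.exists_extend ((Module.Basis.span hv).constr K c)
  have hfv : ∀ i, f (v i) = c i := by
    intro i
    have h := LinearMap.congr_fun hf (Module.Basis.span hv i)
    rw [Module.Basis.constr_basis, LinearMap.comp_apply, Submodule.subtype_apply,
      Module.Basis.span_apply] at h
    exact h
  refine ⟨(fun i => f (0, Pi.single i 1), fun i => f (Pi.single i 1, 0)), fun i => ?_⟩
  rw [← hfv]
  generalize v i = x
  have hx : x = ∑ j, (x.1 j • ((Pi.single j 1, 0) : V6 K) +
      x.2 j • ((0, Pi.single j 1) : V6 K)) := by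
    apply V6_ext <;> simp [Fin.sum_univ_three]
  conv_rhs => rw [hx]
  simp only [map_sum, map_add, map_smul, sympForm, dotProduct, Finset.sum_add_distrib, smul_eq_mul]

theorem hasCommonNeighbours_nonPerp [CharP K 2] : HasCommonNeighbours (NonPerp (K := K)) where
  symm := NonPerp.symm
  pair := by
    rintro _ _ _ _ ⟨a, a', rfl, rfl, ha⟩ ⟨b, b', rfl, rfl, hb⟩
    have ha0 : a ≠ 0 := ne_zero_of_sympForm (b := a') (by rw [ha]; exact one_ne_zero)
    by_cases hli : ∃ s : K, s • a = b
    · obtain ⟨s, rfl⟩ := hli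
      refine ⟨K ∙ a', ?_, ?_⟩ <;> rw [nonPerp_span_iff]
      · rw [ha]
        exact one_ne_zero
      · rintro h
        rw [sympForm_smul_right, sympForm_comm, ha, mul_one] at h
        rw [h, zero_smul, sympForm_zero_left] at hb
        exact zero_ne_one hb
    · push Not at hli
      obtain ⟨w, hw⟩ := exists_sympForm_eq ((LinearIndependent.pair_iff' ha0).2 hli) ![1, 1]
      have h0 : sympForm a w = 1 := hw 0
      have h1 : sympForm b w = 1 := hw 1
      refine ⟨K ∙ w, ?_, ?_⟩ <;> rw [nonPerp_span_iff]
      · rw [h0]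
        exact one_ne_zero
      · rw [sympForm_comm, h1]
        exact one_ne_zero
  edge := by
    rintro _ _ _ _ ⟨x, x', rfl, rfl, hx⟩ ⟨y, z, rfl, rfl, hyz⟩
    simp only [nonPerp_span_iff]
    have hzy : sympForm z y = 1 := by rw [sympForm_comm, hyz]
    have hx0 : x ≠ 0 := ne_zero_of_sympForm (b := x') (by rw [hx]; exact one_ne_zero)
    by_cases hli : ∃ s t : K, s • y + t • z = x
    · obtain ⟨s, t, rfl⟩ := hli
      have h1 : sympForm (s • y + t • z) y = t := by
        rw [sympForm_add_left, sympForm_smul_left, sympForm_smul_left, sympForm_self, hzy]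
        ring
      have h2 : sympForm (s • y + t • z) z = s := by
        rw [sympForm_add_left, sympForm_smul_left, sympForm_smul_left, sympForm_self, hyz]
        ring
      by_cases h : t ≠ 0 ∧ s ≠ 0
      · left
        rwa [h1, h2]
      · -- `x` is one of the two points, and a third point of the line does.
        right
        refine ⟨K ∙ (y + z), ?_⟩
        simp only [nonPerp_span_iff, sympForm_add_left, sympForm_add_right, sympForm_smul_left,
          sympForm_self, hyz, hzy, zero_add, add_zero, mul_one, mul_zero]
        refine ⟨fun h0 => ?_, one_ne_zero, one_ne_zero⟩
        have hst : s = 0 ∧ t = 0 := by grind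
        rw [hst.1, hst.2] at hx0
        simp at hx0
    · right
      push Not at hli
      have hyz' : LinearIndependent K ![y, z] := by
        rw [LinearIndependent.pair_iff]
        intro s t h
        have h1 := congrArg (fun v => sympForm v z) h
        have h2 := congrArg (fun v => sympForm v y) h
        simp only [sympForm_add_left, sympForm_smul_left, sympForm_self, hyz, hzy,
          sympForm_zero_left, mul_zero, mul_one, add_zero, zero_add] at h1 h2
        exact ⟨h1, h2⟩
      have h3 : LinearIndependent K ![x, y, z] := by
        refine linearIndependent_finCons.2 ⟨hyz', ?_⟩
        rw [Matrix.range_cons_cons_empty, Submodule.mem_span_pair]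
        rintro ⟨s, t, h⟩
        exact hli s t h
      obtain ⟨w, hw⟩ := exists_sympForm_eq h3 ![1, 1, 1]
      have h0 : sympForm x w = 1 := hw 0
      have h1 : sympForm y w = 1 := hw 1
      have h2 : sympForm z w = 1 := hw 2
      refine ⟨K ∙ w, ?_⟩
      simp only [nonPerp_span_iff]
      rw [sympForm_comm w, sympForm_comm w, h0, h1, h2]
      exact ⟨one_ne_zero, one_ne_zero, one_ne_zero⟩
  square := by
    intro X Y Z Z' hxz hzy hxz' hzy'
    obtain ⟨x, z, rfl, rfl, -⟩ := id hxz
    obtain ⟨-, y, -, rfl, -⟩ := id hzy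
    obtain ⟨-, z', -, rfl, -⟩ := id hxz'
    simp only [nonPerp_span_iff] at *
    by_contra! hcon
    obtain ⟨hxy, hne, hzz, hw⟩ := hcon
    have hz0 : z ≠ 0 := ne_zero_of_sympForm hzy
    have hz0' : z' ≠ 0 := ne_zero_of_sympForm hzy'
    have hli2 : LinearIndependent K ![z, z'] := by
      refine (LinearIndependent.pair_iff' hz0).2 fun s hs => hne ?_
      exact (span_eq_span_of_mem hz0' (Submodule.mem_span_singleton.2 ⟨s, hs⟩)).symm
    have hli3 : LinearIndependent K ![x, z, z'] := by
      refine linearIndependent_finCons.2 ⟨hli2, ?_⟩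
      rw [Matrix.range_cons_cons_empty, Submodule.mem_span_pair]
      rintro ⟨s, t, rfl⟩
      rw [sympForm_add_left, sympForm_smul_left, sympForm_smul_left, sympForm_self,
        sympForm_comm z', hzz] at hxz
      simp at hxz
    by_cases hy : y ∈ Submodule.span K (Set.range ![x, z, z'])
    · rw [Matrix.range_cons, Matrix.range_cons_cons_empty, Set.singleton_union,
        Submodule.mem_span_triple] at hy
      obtain ⟨r, s, t, rfl⟩ := hy
      obtain ⟨w, hw'⟩ := exists_sympForm_eq hli3 ![1, sympForm x z, sympForm x z']
      have h0 : sympForm x w = 1 := hw' 0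
      have h1 : sympForm z w = sympForm x z := hw' 1
      have h2 : sympForm z' w = sympForm x z' := hw' 2
      -- the value of the form at `y` and `w` is `r`, as `x` and `y` are orthogonal
      have hr : sympForm w (r • x + s • z + t • z') = r := by
        simp only [sympForm_add_right, sympForm_smul_right, sympForm_self] at hxy ⊢
        rw [sympForm_comm w, sympForm_comm w, sympForm_comm w, h0, h1, h2]
        linear_combination hxy
      have hr0 : r ≠ 0 := by
        rintro rfl
        simp [sympForm_add_right, sympForm_smul_right, sympForm_self, hzz] at hzy
      have := hw (K ∙ w)
      simp only [nonPerp_span_iff, hr, sympForm_comm w z, sympForm_comm w z', h0, h1, h2] at this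
      exact this one_ne_zero hr0 hxz hxz'
    · obtain ⟨w, hw'⟩ := exists_sympForm_eq (linearIndependent_finCons.2 ⟨hli3, hy⟩)
        ![1, 1, 1, 1]
      have h0 : sympForm y w = 1 := hw' 0
      have h1 : sympForm x w = 1 := hw' 1
      have h2 : sympForm z w = 1 := hw' 2
      have h3 : sympForm z' w = 1 := hw' 3
      have := hw (K ∙ w)
      simp only [nonPerp_span_iff, sympForm_comm w, h0, h1, h2, h3] at this
      exact this one_ne_zero one_ne_zero one_ne_zero one_ne_zero

end Geometry

/-! ### The standard flag -/

section Flags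

open scoped Matrix

variable {K : Type*} [Field K] [CharP K 2]

theorem smul_span (g : G2 K) (s : Set (V6 K)) :
    g • Submodule.span K s = Submodule.span K (rep6 K g '' s) :=
  Submodule.map_span _ _

theorem smul_span_singleton (g : G2 K) (a : V6 K) : g • (K ∙ a) = K ∙ rep6 K g a := by
  rw [smul_span, Set.image_singleton]

theorem smul_mono (g : G2 K) {U W : Submodule K (V6 K)} (h : U ≤ W) : g • U ≤ g • W :=
  Submodule.map_mono h

theorem smul_le_smul_iff (g : G2 K) {U W : Submodule K (V6 K)} : g • U ≤ g • W ↔ U ≤ W := by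
  refine ⟨fun h => ?_, smul_mono g⟩
  have := smul_mono g⁻¹ h
  rwa [inv_smul_smul, inv_smul_smul] at this

theorem smul_le_iff (g : G2 K) {U W : Submodule K (V6 K)} : g • U ≤ W ↔ U ≤ g⁻¹ • W := by
  rw [← smul_le_smul_iff g (W := g⁻¹ • W), smul_inv_smul]

theorem rep6_injective (g : G2 K) : Function.Injective (rep6 K g) := by
  have h : ∀ x, rep6 K g⁻¹ (rep6 K g x) = x := fun x => by
    rw [← Module.End.mul_apply, ← map_mul, inv_mul_cancel, map_one, Module.End.one_apply]
  exact Function.LeftInverse.injective h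

theorem finrank_smul (g : G2 K) (U : Submodule K (V6 K)) :
    Module.finrank K (g • U : Submodule K (V6 K)) = Module.finrank K U :=
  (Submodule.equivMapOfInjective _ (rep6_injective g) U).finrank_eq.symm

theorem smul_eq_of_le {g : G2 K} {U W : Submodule K (V6 K)} (h : g • U ≤ W)
    (hr : Module.finrank K U = Module.finrank K W) : g • U = W :=
  Submodule.eq_of_le_of_finrank_eq h (by rw [finrank_smul, hr])

theorem isPoint_smul {g : G2 K} {x : Submodule K (V6 K)} : IsPoint (g • x) ↔ IsPoint x := by
  rw [IsPoint, IsPoint, finrank_smul]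

theorem NonPerp.smul (g : G2 K) {x y : Submodule K (V6 K)} (h : NonPerp x y) :
    NonPerp (g • x) (g • y) := by
  obtain ⟨a, b, rfl, rfl, h⟩ := h
  exact ⟨_, _, smul_span_singleton g a, smul_span_singleton g b, by rw [sympForm_rep6, h]⟩

omit [CharP K 2] in
theorem NonPerp.isPoint {x y : Submodule K (V6 K)} (h : NonPerp x y) : IsPoint x := by
  obtain ⟨a, b, rfl, -, h⟩ := h
  exact isPoint_iff.2 ⟨a, ne_zero_of_sympForm (by rw [h]; exact one_ne_zero), rfl⟩

/-- The standard hyperbolic line. -/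
def stdLine (K : Type*) [Field K] : Submodule K (V6 K) := Submodule.span K {E0 K, E4 K}

/-- The standard special plane; the hexagon line in it is spanned by `E4 K` and `E1 K`. -/
def stdPlane (K : Type*) [Field K] : Submodule K (V6 K) := Submodule.span K {E0 K, E4 K, E1 K}

omit [CharP K 2] in
theorem mem_stdLine {x : V6 K} : x ∈ stdLine K ↔ ∃ a b : K, x = (![a, 0, 0], ![b, 0, 0]) := by
  rw [stdLine, Submodule.mem_span_pair]
  have h : ∀ a b : K, a • E0 K + b • E4 K = (![a, 0, 0], ![b, 0, 0]) := fun a b => by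
    apply V6_ext <;> simp [E0, E4]
  simp only [h, eq_comm]

omit [CharP K 2] in
theorem mem_stdPlane {x : V6 K} :
    x ∈ stdPlane K ↔ ∃ a b c : K, x = (![a, c, 0], ![b, 0, 0]) := by
  rw [stdPlane, Submodule.mem_span_triple]
  have h : ∀ a b c : K, a • E0 K + b • E4 K + c • E1 K = (![a, c, 0], ![b, 0, 0]) :=
    fun a b c => by apply V6_ext <;> simp [E0, E4, E1]
  simp only [h, eq_comm]

omit [CharP K 2] in
theorem E0_mem_stdLine : E0 K ∈ stdLine K := Submodule.subset_span (by simp)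

omit [CharP K 2] in
theorem E4_mem_stdLine : E4 K ∈ stdLine K := Submodule.subset_span (by simp)

omit [CharP K 2] in
theorem stdLine_le_stdPlane : stdLine K ≤ stdPlane K :=
  Submodule.span_mono (by simp [Set.insert_subset_iff])

omit [CharP K 2] in
theorem sympForm_E0_E4 : sympForm (E0 K) (E4 K) = 1 := by
  simp [sympForm, E0, E4]

theorem smul_stdLine {g : G2 K} (h0 : rep6 K g (E0 K) ∈ stdLine K)
    (h4 : rep6 K g (E4 K) ∈ stdLine K) : g • stdLine K = stdLine K := by
  refine smul_eq_of_le ?_ rfl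
  rw [stdLine, smul_span, Submodule.span_le, Set.image_subset_iff, Set.insert_subset_iff]
  exact ⟨h0, Set.singleton_subset_iff.2 h4⟩

theorem smul_stdPlane {g : G2 K} (h0 : rep6 K g (E0 K) ∈ stdPlane K)
    (h4 : rep6 K g (E4 K) ∈ stdPlane K) (h1 : rep6 K g (E1 K) ∈ stdPlane K) :
    g • stdPlane K = stdPlane K := by
  refine smul_eq_of_le ?_ rfl
  rw [stdPlane, smul_span, Submodule.span_le, Set.image_subset_iff, Set.insert_subset_iff,
    Set.insert_subset_iff]
  exact ⟨h0, h4, Set.singleton_subset_iff.2 h1⟩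

theorem IsNonsymplecticLine.eq_span_pair {l : Submodule K (V6 K)} (hl : IsNonsymplecticLine l)
    {a b : V6 K} (ha : a ∈ l) (hb : b ∈ l) (hab : sympForm a b ≠ 0) :
    l = Submodule.span K {a, b} := by
  have hba := hab
  rw [sympForm_comm] at hba
  symm
  apply Submodule.eq_of_le_of_finrank_eq
  · rw [Submodule.span_le, Set.insert_subset_iff, Set.singleton_subset_iff]
    exact ⟨ha, hb⟩
  · have hli : LinearIndependent K ![a, b] := by
      rw [LinearIndependent.pair_iff]
      intro s t h
      have h1 := congrArg (fun v => sympForm v b) h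
      have h2 := congrArg (fun v => sympForm v a) h
      simp only [sympForm_add_left, sympForm_smul_left, sympForm_self,
        sympForm_zero_left, mul_zero, add_zero, zero_add, mul_eq_zero, hab, hba, or_false]
        at h1 h2
      exact ⟨h1, h2⟩
    have := finrank_span_eq_card hli
    rw [Matrix.range_cons_cons_empty] at this
    rw [this, hl.1, Fintype.card_fin]

theorem IsNonsymplecticLine.exists_hyperbolic_pair {l x : Submodule K (V6 K)}
    (hl : IsNonsymplecticLine l) (hx : IsPoint x) (hxl : x ≤ l) :
    ∃ a b : V6 K, x = K ∙ a ∧ l = Submodule.span K {a, b} ∧ sympForm a b = 1 := by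
  obtain ⟨a, ha, rfl⟩ := isPoint_iff.1 hx
  rw [Submodule.span_singleton_le_iff_mem] at hxl
  obtain ⟨b, hb, hab⟩ : ∃ b ∈ l, sympForm a b ≠ 0 := by
    obtain ⟨x, hx, y, hy, hxy⟩ := hl.2
    by_contra! hcon
    have h1 := hcon x hx
    have h2 := hcon y hy
    rw [hl.eq_span_pair hx hy hxy, Submodule.mem_span_pair] at hxl
    obtain ⟨s, t, rfl⟩ := hxl
    simp only [sympForm_add_left, sympForm_smul_left, sympForm_self, mul_zero, add_zero, zero_add,
      mul_eq_zero, hxy, sympForm_comm y x, or_false] at h1 h2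
    simp [h1, h2] at ha
  have hs : sympForm a ((sympForm a b)⁻¹ • b) = 1 := by
    rw [sympForm_smul_right, inv_mul_cancel₀ hab]
  exact ⟨a, _, rfl, hl.eq_span_pair hxl (l.smul_mem _ hb) (by rw [hs]; exact one_ne_zero), hs⟩

end Flags

/-! ### Transitivity on flags and on their points -/

section Flags

open scoped Matrix

variable {K : Type*} [Field K] [CharP K 2]

/-- The images of the standard flag under `G₂(K)`. -/
def IsStdFlag (l π : Submodule K (V6 K)) : Prop :=
  ∃ g : G2 K, l = g • stdLine K ∧ π = g • stdPlane K

omit [CharP K 2] in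
theorem IsNonsymplecticLine.exists_isPoint {l : Submodule K (V6 K)} (hl : IsNonsymplecticLine l) :
    ∃ x ≤ l, IsPoint x := by
  obtain ⟨x, hx, y, hy, hxy⟩ := hl.2
  exact ⟨K ∙ x, (Submodule.span_singleton_le_iff_mem _ _).2 hx,
    isPoint_iff.2 ⟨x, ne_zero_of_sympForm hxy, rfl⟩⟩

theorem map_projV6_map (g : G2 K) {H : Submodule K (SplitOctonion K)} (hH : IsNullPlane H) :
    (H.map (g.1 : SplitOctonion K →ₗ[K] SplitOctonion K)).map (projV6 K) ≤
      g • H.map (projV6 K) := by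
  rintro _ ⟨_, ⟨X, hX, rfl⟩, rfl⟩
  refine ⟨projV6 K X, ⟨X, hX, rfl⟩, ?_⟩
  have hX' : X = inclV6 K (projV6 K X) + X.1 • ((1, 1, 0, 0) : SplitOctonion K) := by
    refine Prod.ext ?_ (Prod.ext ?_ ?_) <;> simp [inclV6, projV6, (hH.2.1 X hX).1]
  change projV6 K (g.1 (inclV6 K (projV6 K X))) = projV6 K (g.1 X)
  conv_rhs => rw [hX', map_add, map_smul, octonionAut_map_one, map_add, map_smul]
  simp [projV6]

omit [CharP K 2] in
theorem finrank_stdPlane_le : Module.finrank K (stdPlane K) ≤ 3 := by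
  have := finrank_range_le_card (R := K) ![E0 K, E4 K, E1 K]
  rwa [Set.finrank, Matrix.range_cons, Matrix.range_cons_cons_empty, Set.singleton_union] at this

/-- `G₂(K)` is transitive on the pairs of a nonsymplectic line in a special plane. -/
theorem isStdFlag_of_isSpecialPlane (hK : Function.Surjective (fun x : K => x ^ 2))
    {l π : Submodule K (V6 K)} (hl : IsNonsymplecticLine l) (hπ : IsSpecialPlane π)
    (hle : l ≤ π) : IsStdFlag l π := by
  obtain ⟨x, hxl, hx⟩ := hl.exists_isPoint
  obtain ⟨a, b, -, hlab, hab⟩ := hl.exists_hyperbolic_pair hx hxl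
  obtain ⟨g, hga, hgb⟩ := exists_rep6_eq_E0_E4 hK hab
  have hgl : g • l = stdLine K := by
    rw [hlab, smul_span, Set.image_pair, hga, hgb, stdLine]
  have hle' : stdLine K ≤ g • π := hgl ▸ smul_mono g hle
  have h3 : Module.finrank K (g • π : Submodule K (V6 K)) = 3 := by rw [finrank_smul, hπ.1.1]
  have h2 : Module.finrank K (stdLine K) = 2 := by rw [← hgl, finrank_smul, hl.1]
  obtain ⟨z, hzπ, hzl⟩ : ∃ z ∈ g • π, z ∉ stdLine K := by
    by_contra! hcon
    have := Submodule.finrank_mono (s := g • π) (t := stdLine K) hcon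
    omega
  -- `c` spans the radical of the plane
  obtain ⟨c₁, c₂, c₃, c₄, hz⟩ : ∃ c₁ c₂ c₃ c₄,
      z = z.1 0 • E0 K + z.2 0 • E4 K + perpVec c₁ c₂ c₃ c₄ :=
    ⟨z.1 1, z.1 2, z.2 1, z.2 2, by apply V6_ext <;> simp [E0, E4, perpVec]⟩
  have hline : z.1 0 • E0 K + z.2 0 • E4 K ∈ stdLine K :=
    add_mem (Submodule.smul_mem _ _ E0_mem_stdLine) (Submodule.smul_mem _ _ E4_mem_stdLine)
  have hc : perpVec c₁ c₂ c₃ c₄ ∈ g • π := by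
    rw [← add_sub_cancel_left (z.1 0 • E0 K + z.2 0 • E4 K) (perpVec c₁ c₂ c₃ c₄), ← hz]
    exact sub_mem hzπ (hle' hline)
  have hc' : perpVec c₁ c₂ c₃ c₄ ∉ stdLine K := by
    intro h
    apply hzl
    rw [hz]
    exact add_mem hline h
  have hspan : Submodule.span K {E0 K, E4 K, perpVec c₁ c₂ c₃ c₄} = g • π := by
    apply Submodule.eq_of_le_of_finrank_le
    · rw [Submodule.span_le, Set.insert_subset_iff, Set.insert_subset_iff,
        Set.singleton_subset_iff]
      exact ⟨hle' E0_mem_stdLine, hle' E4_mem_stdLine, hc⟩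
    · have hlt : stdLine K < Submodule.span K {E0 K, E4 K, perpVec c₁ c₂ c₃ c₄} := by
        refine lt_of_le_of_ne (Submodule.span_mono (by simp [Set.insert_subset_iff])) fun h => hc' ?_
        rw [h]
        exact Submodule.subset_span (by simp)
      have := Submodule.finrank_lt_finrank_of_lt hlt
      omega
  obtain ⟨h, hh, hhπ⟩ := hπ.2
  obtain ⟨H, hH, rfl⟩ := hh.exists_isNullPlane
  have hq : c₁ * c₃ + c₂ * c₄ = 0 :=
    (hH.map g).singular ((map_projV6_map g hH).trans (by rw [hspan]; exact smul_mono g hhπ))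
  obtain ⟨g', hg1, hg0, hg4⟩ := exists_rep6_perpVec_eq_E1
    (fun h0 => hc' (h0 ▸ zero_mem _)) hq
  refine ⟨(g' * g)⁻¹, ?_, ?_⟩ <;> rw [eq_inv_smul_iff, mul_smul]
  · rw [hgl, smul_stdLine hg0 hg4]
  · apply Submodule.eq_of_le_of_finrank_le
    · rw [← hspan, smul_span, Submodule.span_le, Set.image_subset_iff, Set.insert_subset_iff,
        Set.insert_subset_iff, Set.singleton_subset_iff]
      refine ⟨stdLine_le_stdPlane hg0, stdLine_le_stdPlane hg4, ?_⟩
      rw [Set.mem_preimage, hg1]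
      exact Submodule.subset_span (by simp)
    · rw [finrank_smul, h3]
      exact finrank_stdPlane_le

/-- The stabiliser of the standard flag is transitive on the points of the line other than the one
on the hexagon line. -/
theorem exists_smul_span_E0_eq (hK : Function.Surjective (fun x : K => x ^ 2))
    {x : Submodule K (V6 K)} (hx : IsPoint x) (hxl : x ≤ stdLine K) (hne : x ≠ K ∙ E4 K) :
    ∃ m : G2 K, m • stdLine K = stdLine K ∧ m • stdPlane K = stdPlane K ∧ x = m • (K ∙ E0 K) := by
  obtain ⟨v, hv, rfl⟩ := isPoint_iff.1 hx
  obtain ⟨a, b, rfl⟩ := mem_stdLine.1 ((Submodule.span_singleton_le_iff_mem _ _).1 hxl)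
  have ha : a ≠ 0 := by
    rintro rfl
    refine hne (span_eq_span_of_mem hv (Submodule.mem_span_singleton.2 ⟨b, ?_⟩))
    apply V6_ext <;> simp [E4]
  obtain ⟨t, ht⟩ := hK (b / a)
  simp only at ht
  have h0 : rep6 K (lowerG2 ![t, 0, 0]) (E0 K) = (![1, 0, 0], ![b / a, 0, 0]) := by
    rw [rep6_lowerG2, ← ht]
    apply V6_ext <;> simp [E0, cross_apply, dotProduct_fin_three, -Matrix.cons_dotProduct,
      -Matrix.dotProduct_cons]
    ring
  have h4 : rep6 K (lowerG2 ![t, 0, 0]) (E4 K) = E4 K := by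
    rw [rep6_lowerG2]
    apply V6_ext <;> simp [E4, cross_apply, dotProduct_fin_three, -Matrix.cons_dotProduct,
      -Matrix.dotProduct_cons]
  have h1 : rep6 K (lowerG2 ![t, 0, 0]) (E1 K) = E1 K := by
    rw [rep6_lowerG2]
    apply V6_ext <;> simp [E1, cross_apply, dotProduct_fin_three, -Matrix.cons_dotProduct,
      -Matrix.dotProduct_cons]
  have h0l : rep6 K (lowerG2 ![t, 0, 0]) (E0 K) ∈ stdLine K := mem_stdLine.2 ⟨_, _, h0⟩
  refine ⟨lowerG2 ![t, 0, 0], smul_stdLine h0l (h4.symm ▸ E4_mem_stdLine),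
    smul_stdPlane (stdLine_le_stdPlane h0l) ?_ ?_, ?_⟩
  · rw [h4]
    exact stdLine_le_stdPlane E4_mem_stdLine
  · rw [h1]
    exact Submodule.subset_span (by simp)
  · rw [smul_span_singleton, h0]
    refine span_eq_span_of_mem hv (Submodule.mem_span_singleton.2 ⟨a, ?_⟩)
    apply V6_ext <;> simp
    field_simp

/-- The stabiliser of the standard plane and one of the points `x` spanned by `E0 K` and `E4 K` is
transitive on the hyperbolic lines through `x` in the plane. -/
theorem exists_smul_le_stdLine {x y : Submodule K (V6 K)} (hx : x = K ∙ E0 K ∨ x = K ∙ E4 K)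
    (hy : y ≤ stdPlane K) (hxy : NonPerp x y) :
    ∃ n : G2 K, n • stdPlane K = stdPlane K ∧ n • x = x ∧ n • y ≤ stdLine K := by
  obtain ⟨v, hv, rfl⟩ := isPoint_iff.1 hxy.symm.isPoint
  obtain ⟨a, b, c, rfl⟩ := mem_stdPlane.1 ((Submodule.span_singleton_le_iff_mem _ _).1 hy)
  have hstd : ∀ {n : G2 K}, (∀ a b c : K, rep6 K n (![a, c, 0], ![b, 0, 0]) ∈ stdPlane K) →
      n • stdPlane K = stdPlane K := fun h => smul_stdPlane (h 1 0 0) (h 0 1 0) (h 0 0 1)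
  rcases hx with rfl | rfl
  · have hb : b ≠ 0 := by
      rw [nonPerp_span_iff] at hxy
      simpa [sympForm, E0, dotProduct_fin_three] using hxy
    have hn : ∀ a' b' c' : K, rep6 K (lowerG2 ![0, 0, c / b]) (![a', c', 0], ![b', 0, 0]) =
        (![a', c' + c / b * b', 0], ![b', 0, 0]) := by
      intro a' b' c'
      rw [rep6_lowerG2]
      apply V6_ext <;> simp [cross_apply, dotProduct_fin_three, -Matrix.cons_dotProduct,
        -Matrix.dotProduct_cons]
    refine ⟨lowerG2 ![0, 0, c / b], hstd fun a' b' c' => mem_stdPlane.2 ⟨_, _, _, hn a' b' c'⟩,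
      ?_, ?_⟩
    · rw [smul_span_singleton, E0, hn]
      simp
    · rw [smul_span_singleton, Submodule.span_singleton_le_iff_mem, hn, mem_stdLine]
      refine ⟨a, b, ?_⟩
      rw [div_mul_cancel₀ _ hb, CharTwo.add_self_eq_zero]
  · have ha : a ≠ 0 := by
      rw [nonPerp_span_iff] at hxy
      simpa [sympForm, E4, dotProduct_fin_three] using hxy
    obtain ⟨n, hn'⟩ := exists_rep6_eq_mulVec !![1, 0, 0; - c / a, 1, 0; 0, 0, 1]
      (by simp [Matrix.det_fin_three])
    have hn : ∀ a' b' c' : K, rep6 K n (![a', c', 0], ![b', 0, 0]) =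
        (![a', - c / a * a' + c', 0], ![b', 0, 0]) := by
      intro a' b' c'
      rw [hn', Matrix.adjugate_fin_three]
      apply V6_ext <;> simp [Matrix.mulVec, Matrix.vecMul, dotProduct_fin_three,
        -Matrix.cons_dotProduct, -Matrix.dotProduct_cons]
    refine ⟨n, hstd fun a' b' c' => mem_stdPlane.2 ⟨_, _, _, hn a' b' c'⟩, ?_, ?_⟩
    · rw [smul_span_singleton, E4, hn]
      simp
    · rw [smul_span_singleton, Submodule.span_singleton_le_iff_mem, hn, mem_stdLine]
      refine ⟨a, b, ?_⟩
      rw [div_mul_cancel₀ _ ha, neg_add_cancel]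

theorem IsStdFlag.le {l π : Submodule K (V6 K)} (h : IsStdFlag l π) : l ≤ π := by
  obtain ⟨g, rfl, rfl⟩ := h
  exact smul_mono g stdLine_le_stdPlane

/-- The stabiliser of a flag is transitive on the points of its line other than one point `x₀`, the
point on the hexagon line. -/
theorem IsStdFlag.exists_point (hK : Function.Surjective (fun x : K => x ^ 2))
    {l π : Submodule K (V6 K)} (h : IsStdFlag l π) :
    ∃ x₀, ∀ x y : Submodule K (V6 K), IsPoint x → IsPoint y → x ≤ l → y ≤ l → x ≠ x₀ → y ≠ x₀ →
      ∃ m : G2 K, m • l = l ∧ m • π = π ∧ y = m • x := by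
  obtain ⟨g, rfl, rfl⟩ := h
  refine ⟨g • (K ∙ E4 K), fun x y hx hy hxl hyl hx₀ hy₀ => ?_⟩
  obtain ⟨m, hm1, hm2, hm3⟩ := exists_smul_span_E0_eq hK (x := g⁻¹ • x) (isPoint_smul.2 hx)
    (by rwa [smul_le_iff, inv_inv]) (by rwa [Ne, inv_smul_eq_iff])
  obtain ⟨n, hn1, hn2, hn3⟩ := exists_smul_span_E0_eq hK (x := g⁻¹ • y) (isPoint_smul.2 hy)
    (by rwa [smul_le_iff, inv_inv]) (by rwa [Ne, inv_smul_eq_iff])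
  refine ⟨g * n * m⁻¹ * g⁻¹, ?_, ?_, ?_⟩ <;> simp only [mul_smul, inv_smul_smul]
  · rw [inv_smul_eq_iff.2 hm1.symm, hn1]
  · rw [inv_smul_eq_iff.2 hm2.symm, hn2]
  · rw [hm3, inv_smul_smul, ← hn3, smul_inv_smul]

/-- The stabiliser of a special plane and of a point `x` is transitive on the hyperbolic lines
through `x` in the plane. -/
theorem IsStdFlag.exists_smul_le (hK : Function.Surjective (fun x : K => x ^ 2))
    {l π x y : Submodule K (V6 K)} (h : IsStdFlag l π) (hxl : x ≤ l) (hy : y ≤ π)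
    (hxy : NonPerp x y) : ∃ n : G2 K, n • π = π ∧ n • x = x ∧ n • y ≤ l := by
  obtain ⟨g, rfl, rfl⟩ := h
  obtain ⟨m, hml, hmπ, hmx⟩ : ∃ m : G2 K, m • stdLine K = stdLine K ∧
      m • stdPlane K = stdPlane K ∧
      (m⁻¹ • g⁻¹ • x = K ∙ E0 K ∨ m⁻¹ • g⁻¹ • x = K ∙ E4 K) := by
    by_cases hx : g⁻¹ • x = K ∙ E4 K
    · exact ⟨1, one_smul _ _, one_smul _ _, Or.inr (by rw [inv_one, one_smul, hx])⟩
    · obtain ⟨m, hm1, hm2, hm3⟩ := exists_smul_span_E0_eq hK (x := g⁻¹ • x)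
        (isPoint_smul.2 hxy.isPoint) (by rwa [smul_le_iff, inv_inv]) hx
      exact ⟨m, hm1, hm2, Or.inl (by rw [hm3, inv_smul_smul])⟩
  obtain ⟨n, hn1, hn2, hn3⟩ := exists_smul_le_stdLine hmx (y := m⁻¹ • g⁻¹ • y)
    (by rwa [smul_le_iff, inv_inv, hmπ, smul_le_iff, inv_inv]) ((hxy.smul g⁻¹).smul m⁻¹)
  refine ⟨g * m * n * m⁻¹ * g⁻¹, ?_, ?_, ?_⟩ <;> simp only [mul_smul, inv_smul_smul]
  · rw [inv_smul_eq_iff.2 hmπ.symm, hn1, hmπ]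
  · rw [hn2, smul_inv_smul, smul_inv_smul]
  · rw [smul_le_smul_iff, ← hml, smul_le_smul_iff]
    exact hn3

/-- Only the radical of a special plane is orthogonal to a hyperbolic line in it. -/
theorem IsStdFlag.exists_nonPerp {l π y z : Submodule K (V6 K)} (h : IsStdFlag l π) (hy : y ≤ π)
    (hz : z ≤ π) (hyz : NonPerp y z) : ∃ x ≤ l, NonPerp x y := by
  obtain ⟨g, rfl, rfl⟩ := h
  suffices h : ∃ x ≤ stdLine K, NonPerp x (g⁻¹ • y) by
    obtain ⟨x, hx, hxy⟩ := h
    refine ⟨g • x, smul_mono g hx, ?_⟩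
    have := hxy.smul g
    rwa [smul_inv_smul] at this
  have hyz' := hyz.smul g⁻¹
  obtain ⟨v, w, hv, hw, hvw⟩ := hyz'
  have hvπ : v ∈ stdPlane K := by
    rw [← Submodule.span_singleton_le_iff_mem, ← hv, smul_le_iff, inv_inv]
    exact hy
  have hwπ : w ∈ stdPlane K := by
    rw [← Submodule.span_singleton_le_iff_mem, ← hw, smul_le_iff, inv_inv]
    exact hz
  rw [hv]
  obtain ⟨a, b, c, rfl⟩ := mem_stdPlane.1 hvπ
  obtain ⟨a', b', c', rfl⟩ := mem_stdPlane.1 hwπ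
  by_cases ha : a = 0
  · refine ⟨K ∙ E0 K, (Submodule.span_singleton_le_iff_mem _ _).2 E0_mem_stdLine, ?_⟩
    rw [nonPerp_span_iff]
    rintro hb
    simp [sympForm, E0] at hb hvw
    simp [ha, hb] at hvw
  · refine ⟨K ∙ E4 K, (Submodule.span_singleton_le_iff_mem _ _).2 E4_mem_stdLine, ?_⟩
    rw [nonPerp_span_iff]
    simpa [sympForm, E4, dotProduct_fin_three] using ha

end Flags

/-! ### Triangles in special planes -/

section Triangles

open scoped Matrix

variable {K : Type*} [Field K] [CharP K 2]

/-- All three points lie in a common image of the plane `π`. -/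
def InCommonPlane (π x y z : Submodule K (V6 K)) : Prop :=
  ∃ u : G2 K, ∀ t ∈ ({x, y, z} : Set (Submodule K (V6 K))), t ≤ u • π

theorem inCommonPlane_of_rep6_mem {c₁ c₂ c₃ c₄ : K} (hq : c₁ * c₃ + c₂ * c₄ = 0) (g : G2 K)
    {x y z : V6 K}
    (h : ∀ t ∈ ({x, y, z} : Set (V6 K)),
      ∃ r s k : K, rep6 K g t = r • E0 K + s • E4 K + k • perpVec c₁ c₂ c₃ c₄) :
    InCommonPlane (stdPlane K) (K ∙ x) (K ∙ y) (K ∙ z) := by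
  obtain ⟨u, hu⟩ : ∃ u : G2 K, ∀ r s k : K,
      rep6 K u (r • E0 K + s • E4 K + k • perpVec c₁ c₂ c₃ c₄) ∈ stdPlane K := by
    have hl : ∀ r s : K, r • E0 K + s • E4 K ∈ stdPlane K := fun r s => stdLine_le_stdPlane
      (add_mem (Submodule.smul_mem _ _ E0_mem_stdLine) (Submodule.smul_mem _ _ E4_mem_stdLine))
    by_cases hc : perpVec c₁ c₂ c₃ c₄ = 0
    · refine ⟨1, fun r s k => ?_⟩
      rw [map_one, Module.End.one_apply, hc, smul_zero, add_zero]
      exact hl r s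
    · obtain ⟨u, h1, h0, h4⟩ := exists_rep6_perpVec_eq_E1 hc hq
      refine ⟨u, fun r s k => ?_⟩
      simp only [map_add, map_smul, h1]
      exact add_mem (add_mem (Submodule.smul_mem _ _ (stdLine_le_stdPlane h0))
        (Submodule.smul_mem _ _ (stdLine_le_stdPlane h4)))
        (Submodule.smul_mem _ _ (Submodule.subset_span (by simp)))
  have key : ∀ t ∈ ({x, y, z} : Set (V6 K)), (K ∙ t) ≤ (u * g)⁻¹ • stdPlane K := by
    intro t ht
    obtain ⟨r, s, k, hk⟩ := h t ht
    rw [← smul_le_iff, smul_span_singleton, Submodule.span_singleton_le_iff_mem, map_mul,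
      Module.End.mul_apply, hk]
    exact hu r s k
  refine ⟨(u * g)⁻¹, ?_⟩
  simp only [Set.mem_insert_iff, Set.mem_singleton_iff, forall_eq_or_imp, forall_eq] at key ⊢
  exact key

/-- A triangle whose radical is nonsingular is filled by three triangles in special planes: the
radical is the sum of two singular vectors, and the fourth point arises from the third point by
dropping one of them. -/
theorem exists_fill_std {z : Submodule K (V6 K)} (h0 : NonPerp (K ∙ E0 K) z)
    (h4 : NonPerp (K ∙ E4 K) z) :
    InCommonPlane (stdPlane K) (K ∙ E0 K) (K ∙ E4 K) z ∨
      ∃ w, NonPerp w (K ∙ E0 K) ∧ NonPerp w (K ∙ E4 K) ∧ NonPerp w z ∧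
        InCommonPlane (stdPlane K) (K ∙ E0 K) (K ∙ E4 K) w ∧
        InCommonPlane (stdPlane K) (K ∙ E4 K) z w ∧
        InCommonPlane (stdPlane K) (K ∙ E0 K) z w := by
  obtain ⟨v, -, rfl⟩ := isPoint_iff.1 h0.symm.isPoint
  rw [nonPerp_span_iff] at h0 h4
  obtain ⟨α, β, a, b, c, d, rfl⟩ : ∃ α β a b c d : K,
      v = α • E0 K + β • E4 K + perpVec a b c d :=
    ⟨v.1 0, v.2 0, v.1 1, v.1 2, v.2 1, v.2 2, by apply V6_ext <;> simp [E0, E4, perpVec]⟩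
  have hβ : β ≠ 0 := by
    simpa [sympForm, E0, E4, perpVec, dotProduct_fin_three] using h0
  have hα : α ≠ 0 := by
    simpa [sympForm, E0, E4, perpVec, dotProduct_fin_three] using h4
  have triv : ∀ {c₁ c₂ c₃ c₄ : K}, c₁ * c₃ + c₂ * c₄ = 0 →
      InCommonPlane (stdPlane K) (K ∙ E0 K) (K ∙ E4 K)
        (K ∙ (α • E0 K + β • E4 K + perpVec c₁ c₂ c₃ c₄)) := by
    intro c₁ c₂ c₃ c₄ hq
    refine inCommonPlane_of_rep6_mem hq 1 ?_
    simp only [map_one, Module.End.one_apply, Set.mem_insert_iff, Set.mem_singleton_iff,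
      forall_eq_or_imp, forall_eq]
    exact ⟨⟨1, 0, 0, by simp⟩, ⟨0, 1, 0, by simp⟩, ⟨α, β, 1, by simp⟩⟩
  by_cases hq : a * c + b * d = 0
  · exact Or.inl (triv hq)
  · right
    refine ⟨K ∙ (α • E0 K + β • E4 K + perpVec a b 0 0), ?_, ?_, ?_, triv (by simp), ?_, ?_⟩
    · rw [nonPerp_span_iff]
      simpa [sympForm, E0, E4, perpVec, dotProduct_fin_three] using hβ
    · rw [nonPerp_span_iff]
      simpa [sympForm, E0, E4, perpVec, dotProduct_fin_three] using hα
    · rw [nonPerp_span_iff]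
      intro h
      simp [sympForm, E0, E4, perpVec] at h
      exact hq (by grind)
    · -- a transvection of `SL₃(K)` that fixes `E4 K`
      obtain ⟨g, hg⟩ := exists_rep6_eq_mulVec !![1, 0, 0; -a / α, 1, 0; -b / α, 0, 1]
        (by simp [Matrix.det_fin_three])
      refine inCommonPlane_of_rep6_mem (c₁ := 0) (c₂ := 0) (c₃ := c) (c₄ := d) (by simp) g ?_
      simp only [Set.mem_insert_iff, Set.mem_singleton_iff, forall_eq_or_imp, forall_eq]
      refine ⟨⟨0, 1, 0, ?_⟩, ⟨α, β + (a * c + b * d) / α, 1, ?_⟩, ⟨α, β, 0, ?_⟩⟩ <;>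
        rw [hg, Matrix.adjugate_fin_three] <;> apply V6_ext <;>
        simp [E0, E4, perpVec, Matrix.mulVec, Matrix.vecMul, dotProduct_fin_three, hα,
          -Matrix.cons_dotProduct, -Matrix.dotProduct_cons]
      field_simp
      ring
    · -- a unipotent element that fixes `E0 K`
      refine inCommonPlane_of_rep6_mem (c₁ := 0) (c₂ := 0) (c₃ := c) (c₄ := d) (by simp)
        (lowerG2 ![0, b / β, a / β]) ?_
      simp only [Set.mem_insert_iff, Set.mem_singleton_iff, forall_eq_or_imp, forall_eq]
      refine ⟨⟨1, 0, 0, ?_⟩, ⟨α + (a * c + b * d) / β, β, 1, ?_⟩, ⟨α, β, 0, ?_⟩⟩ <;>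
        rw [rep6_lowerG2] <;> apply V6_ext <;>
        simp [E0, E4, perpVec, cross_apply, dotProduct_fin_three, hβ,
          -Matrix.cons_dotProduct, -Matrix.dotProduct_cons] <;> grind

theorem exists_rep6_pair (hK : Function.Surjective (fun x : K => x ^ 2)) {a b a' b' : V6 K}
    (h : sympForm a b = 1) (h' : sympForm a' b' = 1) :
    ∃ g : G2 K, rep6 K g a = a' ∧ rep6 K g b = b' := by
  obtain ⟨g, hga, hgb⟩ := exists_rep6_eq_E0_E4 hK h
  obtain ⟨k, hka, hkb⟩ := exists_rep6_eq_E0_E4 hK h'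
  have hinv : ∀ x, rep6 K k⁻¹ (rep6 K k x) = x := fun x => by
    rw [← Module.End.mul_apply, ← map_mul, inv_mul_cancel, map_one, Module.End.one_apply]
  refine ⟨k⁻¹ * g, ?_, ?_⟩ <;> rw [map_mul, Module.End.mul_apply]
  · rw [hga, ← hka, hinv]
  · rw [hgb, ← hkb, hinv]

theorem InCommonPlane.smul {π x y z : Submodule K (V6 K)} (h : InCommonPlane π x y z) (g k : G2 K) :
    InCommonPlane (k • π) (g • x) (g • y) (g • z) := by
  obtain ⟨u, hu⟩ := h
  refine ⟨g * u * k⁻¹, ?_⟩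
  simp only [mul_smul, inv_smul_smul]
  simp only [Set.mem_insert_iff, Set.mem_singleton_iff, forall_eq_or_imp, forall_eq] at hu ⊢
  exact ⟨smul_mono g hu.1, smul_mono g hu.2.1, smul_mono g hu.2.2⟩

theorem IsStdFlag.exists_fill (hK : Function.Surjective (fun x : K => x ^ 2))
    {l π x y z : Submodule K (V6 K)} (h : IsStdFlag l π) (hxy : NonPerp x y) (hyz : NonPerp y z)
    (hxz : NonPerp x z) :
    InCommonPlane π x y z ∨ ∃ w, NonPerp w x ∧ NonPerp w y ∧ NonPerp w z ∧
      InCommonPlane π x y w ∧ InCommonPlane π y z w ∧ InCommonPlane π x z w := by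
  obtain ⟨k, -, rfl⟩ := h
  obtain ⟨a, b, rfl, rfl, hab⟩ := hxy
  obtain ⟨g, hga, hgb⟩ := exists_rep6_pair hK sympForm_E0_E4 hab
  have hx : g • (K ∙ E0 K) = K ∙ a := by rw [smul_span_singleton, hga]
  have hy : g • (K ∙ E4 K) = K ∙ b := by rw [smul_span_singleton, hgb]
  have h0 := hxz.smul g⁻¹
  have h4 := hyz.smul g⁻¹
  rw [← hx, inv_smul_smul] at h0
  rw [← hy, inv_smul_smul] at h4
  rw [← hx, ← hy, ← smul_inv_smul g z]
  rcases exists_fill_std h0 h4 with h | ⟨w, hw0, hw4, hwz, h1, h2, h3⟩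
  · exact Or.inl (h.smul g k)
  · exact Or.inr ⟨g • w, hw0.smul g, hw4.smul g, hwz.smul g, h1.smul g k, h2.smul g k, h3.smul g k⟩

end Triangles

/-! ### The covering conditions for a chamber -/

section FlagGraph

variable {K : Type*} [Field K] [CharP K 2]

theorem IsNonsymplecticLine.eq_or_nonPerp {l x y : Submodule K (V6 K)}
    (hl : IsNonsymplecticLine l) (hx : IsPoint x) (hy : IsPoint y) (hxl : x ≤ l) (hyl : y ≤ l) :
    y = x ∨ NonPerp x y := by
  obtain ⟨a, b, rfl, rfl, hab⟩ := hl.exists_hyperbolic_pair hx hxl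
  obtain ⟨v, hv, rfl⟩ := isPoint_iff.1 hy
  rw [Submodule.span_singleton_le_iff_mem, Submodule.mem_span_pair] at hyl
  obtain ⟨s, t, rfl⟩ := hyl
  by_cases ht : t = 0
  · left
    exact span_eq_span_of_mem hv (Submodule.mem_span_singleton.2 ⟨s, by simp [ht]⟩)
  · right
    rw [nonPerp_span_iff, sympForm_add_right, sympForm_smul_right, sympForm_smul_right, hab,
      sympForm_self]
    simpa using ht

theorem IsNonsymplecticLine.eq_sup {l x y : Submodule K (V6 K)} (hl : IsNonsymplecticLine l)
    (hxy : NonPerp x y) (hxl : x ≤ l) (hyl : y ≤ l) : l = x ⊔ y := by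
  obtain ⟨a, b, rfl, rfl, hab⟩ := hxy
  rw [Submodule.span_singleton_le_iff_mem] at hxl hyl
  rw [hl.eq_span_pair hxl hyl (by rw [hab]; exact one_ne_zero), Submodule.span_insert]

theorem smul_subspace_sup (g : G2 K) (U W : Submodule K (V6 K)) : g • (U ⊔ W) = g • U ⊔ g • W :=
  Submodule.map_sup _ _ _

/-- An element that maps two points of a nonsymplectic line to points of this line stabilises
the line. -/
theorem IsNonsymplecticLine.smul_eq {l x y : Submodule K (V6 K)} (hl : IsNonsymplecticLine l)
    (hxy : NonPerp x y) (hxl : x ≤ l) (hyl : y ≤ l) {g : G2 K} (hgx : g • x ≤ l)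
    (hgy : g • y ≤ l) : g • l = l := by
  refine smul_eq_of_le ?_ rfl
  conv_lhs => rw [hl.eq_sup hxy hxl hyl]
  rw [smul_subspace_sup]
  exact sup_le hgx hgy

variable {p l π : Submodule K (V6 K)} {g : G2 K}

/-- Every point of the line is a representative up to the stabiliser of the flag. -/
theorem IsStdFlag.exists_eq_smul (hK : Function.Surjective (fun x : K => x ^ 2))
    (h : IsStdFlag l π) (hp : IsPoint p) (hpl : p ≤ l) (hg : g • l = l)
    (horb : ∀ h : G2 K, h • p = p → h • l = l → h • π ≠ g • π)
    {x : Submodule K (V6 K)} (hx : IsPoint x) (hxl : x ≤ l) :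
    ∃ m : G2 K, m • l = l ∧ m • π = π ∧ ∃ d ∈ ({1, g⁻¹} : Set (G2 K)), x = m • d • p := by
  obtain ⟨x₀, hx₀⟩ := h.exists_point hK
  have hp' : IsPoint (g⁻¹ • p) := isPoint_smul.2 hp
  have hpl' : g⁻¹ • p ≤ l := by rwa [smul_le_iff, inv_inv, hg]
  by_cases h1 : x = x₀
  · by_cases h2 : p = x₀
    · exact ⟨1, one_smul _ _, one_smul _ _, 1, by simp, by rw [one_smul, one_smul, h1, h2]⟩
    · by_cases h3 : g⁻¹ • p = x₀
      · exact ⟨1, one_smul _ _, one_smul _ _, g⁻¹, by simp, by rw [one_smul, h3, h1]⟩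
      · obtain ⟨m, hm1, hm2, hm3⟩ := hx₀ p _ hp hp' hpl hpl' h2 h3
        refine absurd ?_ (horb (g * m) ?_ ?_) <;> rw [mul_smul]
        · rw [hm2]
        · rw [← hm3, smul_inv_smul]
        · rw [hm1, hg]
  · by_cases h2 : p = x₀
    · have h3 : g⁻¹ • p ≠ x₀ := by
        rw [← h2]
        intro h
        exact horb g (inv_smul_eq_iff.1 h).symm hg rfl
      obtain ⟨m, hm1, hm2, hm3⟩ := hx₀ _ x hp' hx hpl' hxl h3 h1
      exact ⟨m, hm1, hm2, g⁻¹, by simp, hm3⟩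
    · obtain ⟨m, hm1, hm2, hm3⟩ := hx₀ _ x hp hx hpl hxl h2 h1
      exact ⟨m, hm1, hm2, 1, by simp, by rw [one_smul, hm3]⟩

/-- The two representative points are not in the same orbit of the stabiliser of the plane. -/
theorem IsStdFlag.smul_ne (hK : Function.Surjective (fun x : K => x ^ 2))
    (h : IsStdFlag l π) (hl : IsNonsymplecticLine l) (hp : IsPoint p) (hpl : p ≤ l)
    (hg : g • l = l) (horb : ∀ h : G2 K, h • p = p → h • l = l → h • π ≠ g • π)
    {r : G2 K} (hr : r • π = π) : r • p ≠ g⁻¹ • p := by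
  intro hrp
  have hpl' : g⁻¹ • p ≤ l := by rwa [smul_le_iff, inv_inv, hg]
  have hne : NonPerp p (g⁻¹ • p) := by
    refine (hl.eq_or_nonPerp hp (isPoint_smul.2 hp) hpl hpl').resolve_left fun h => ?_
    exact horb g (inv_smul_eq_iff.1 h).symm hg rfl
  have hne' := hne.smul r
  rw [hrp] at hne'
  obtain ⟨s, hs1, hs2, hs3⟩ := h.exists_smul_le hK hpl' (y := r • g⁻¹ • p)
    (by
      have := smul_mono r (hpl'.trans h.le)
      rwa [hr] at this) hne'
  have hsl : (s * r) • l = l := hl.smul_eq hne hpl hpl' (by rwa [mul_smul, hrp, hs2])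
    (by rwa [mul_smul])
  refine horb (g * (s * r)) ?_ ?_ ?_ <;> rw [mul_smul]
  · rw [mul_smul s, hrp, hs2, smul_inv_smul]
  · rw [hsl, hg]
  · rw [mul_smul, hr, hs1]

/-- The graph of non-orthogonal points satisfies the conditions of the covering argument. -/
theorem IsStdFlag.isFlagGraph (hK : Function.Surjective (fun x : K => x ^ 2))
    (h : IsStdFlag l π) (hl : IsNonsymplecticLine l) (hp : IsPoint p) (hpl : p ≤ l)
    (hg : g • l = l) (horb : ∀ h : G2 K, h • p = p → h • l = l → h • π ≠ g • π) :
    IsFlagGraph (G := G2 K) NonPerp p l π {1, g⁻¹} := by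
  have hD : ∀ d ∈ ({1, g⁻¹} : Set (G2 K)), d • l = l := by
    rintro d (rfl | rfl)
    · exact one_smul _ _
    · exact inv_smul_eq_iff.2 hg.symm
  have hDp : ∀ {d k : G2 K}, d ∈ ({1, g⁻¹} : Set (G2 K)) → k • l = l → k • d • p ≤ l := by
    intro d k hd hk
    have := smul_mono k (smul_mono d hpl)
    rwa [hD d hd, hk] at this
  have hkp : ∀ {k : G2 K}, k • l = l → k • p ≤ l := by
    intro k hk
    have := smul_mono k hpl
    rwa [hk] at this
  obtain ⟨a, b, hpa, hlab, hab⟩ := hl.exists_hyperbolic_pair hp hpl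
  have hbl : (K ∙ b) ≤ l := by
    rw [hlab]
    exact Submodule.span_mono (by simp)
  have hpb : NonPerp p (K ∙ b) := ⟨a, b, hpa, rfl, hab⟩
  refine
    { common := hasCommonNeighbours_nonPerp
      smul := fun k x y hxy => hxy.smul k
      exists_adj := ⟨_, hpb⟩
      edge := ?_
      line_adj := fun k hk => hl.eq_or_nonPerp hp (isPoint_smul.2 hp) hpl (hkp hk)
      line_unique := ?_
      plane_edge := ?_
      plane_connected := ?_
      triangle := ?_ }
  · intro y hy
    obtain ⟨b', -, rfl⟩ := isPoint_iff.1 hy.symm.isPoint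
    rw [hpa, nonPerp_span_iff] at hy
    have hs : sympForm a ((sympForm a b')⁻¹ • b') = 1 := by
      rw [sympForm_smul_right, inv_mul_cancel₀ hy]
    obtain ⟨k, hka, hkb⟩ := exists_rep6_pair hK hab (by rwa [sympForm_comm] at hab :
      sympForm b a = 1)
    obtain ⟨r, hra, hrb⟩ := exists_rep6_pair hK hab hs
    refine ⟨r, k, ?_, ?_, ?_⟩
    · rw [hpa, smul_span_singleton, hra]
    · rw [hlab, smul_span, Set.image_pair, hka, hkb, Set.pair_comm]
    · rw [hpa, smul_span_singleton, hka, smul_span_singleton, hrb]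
      exact (Submodule.span_singleton_smul_eq (isUnit_iff_ne_zero.2 (inv_ne_zero hy)) b').symm
  · intro r k k' hr hk hk' _ hk2 he
    exact hl.smul_eq hk2 hpl (hkp hk') (by rwa [hr]) (by rw [← he]; exact hkp hk)
  · intro d hd d' hd' k hk hadj
    have hdl : d • p ≤ l := by simpa using hDp hd (one_smul (G2 K) l)
    have hkd : k • d' • p ≤ π := by
      have := smul_mono k ((hDp hd' (one_smul (G2 K) l)).trans h.le)
      rwa [one_smul, hk] at this
    obtain ⟨n, hn1, hn2, hn3⟩ := h.exists_smul_le hK hdl hkd hadj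
    obtain ⟨m, hm1, hm2, d'', hd'', he⟩ := h.exists_eq_smul hK hp hpl hg horb
      (isPoint_smul.2 hadj.symm.isPoint) hn3
    refine ⟨n, m, hn1, hn2, hm1, hm2, ?_⟩
    rw [he]
    have hmi : m⁻¹ • π = π := inv_smul_eq_iff.2 hm2.symm
    have hrπ : (m⁻¹ * n * k) • π = π := by rw [mul_smul, mul_smul, hk, hn1, hmi]
    have hsep := h.smul_ne hK hl hp hpl hg horb (r := m⁻¹ * n * k) hrπ
    have hsep' := h.smul_ne hK hl hp hpl hg horb (r := (m⁻¹ * n * k)⁻¹)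
      (inv_smul_eq_iff.2 hrπ.symm)
    rcases hd' with rfl | rfl <;> rcases hd'' with rfl | rfl
    · rfl
    · rw [one_smul] at he
      exact absurd (by rw [mul_smul, mul_smul, he, inv_smul_smul]) hsep
    · rw [one_smul] at he
      exact absurd (by rw [inv_smul_eq_iff, mul_smul, mul_smul, he, inv_smul_smul]) hsep'
    · rfl
  · intro k hk
    have hkπ : ∀ {x}, x ≤ π → k • x ≤ π := by
      intro x hx
      have := smul_mono k hx
      rwa [hk] at this
    obtain ⟨y, hyl, hpy, hyk⟩ : ∃ y ≤ l, NonPerp p y ∧ NonPerp y (k • p) := by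
      obtain ⟨x, hxl, hx⟩ := h.exists_nonPerp (hkπ (hpl.trans h.le)) (hkπ (hbl.trans h.le))
        (hpb.smul k)
      rcases hl.eq_or_nonPerp hp hx.isPoint hpl hxl with rfl | hpx
      · -- one of the two other points spanned by `b` and `a + b` is not orthogonal to `k • p`
        obtain ⟨c, -, hc⟩ := isPoint_iff.1 hx.symm.isPoint
        rw [hc, hpa, nonPerp_span_iff] at hx
        by_cases hbc : sympForm b c = 0
        · refine ⟨K ∙ (a + b), ?_, ?_, ?_⟩
          · rw [Submodule.span_singleton_le_iff_mem, hlab]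
            exact add_mem (Submodule.subset_span (by simp)) (Submodule.subset_span (by simp))
          · rw [hpa, nonPerp_span_iff, sympForm_add_right, sympForm_self, hab, zero_add]
            exact one_ne_zero
          · rwa [hc, nonPerp_span_iff, sympForm_add_left, hbc, add_zero]
        · exact ⟨_, hbl, hpb, by rwa [hc, nonPerp_span_iff]⟩
      · exact ⟨x, hxl, hpx, hx⟩
    obtain ⟨m, -, hm2, d, hd, rfl⟩ := h.exists_eq_smul hK hp hpl hg horb hpy.symm.isPoint hyl
    exact ⟨m, hm2, d, hd, hpy, hyk⟩
  · intro x y z hxy hyz hxz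
    have conv : ∀ {x y z}, NonPerp x y → NonPerp y z → InCommonPlane π x y z →
        ∃ u : G2 K, ∀ t ∈ ({x, y, z} : Set _),
          ∃ k : G2 K, k • π = π ∧ ∃ d ∈ ({1, g⁻¹} : Set (G2 K)), t = u • k • d • p := by
      rintro x y z hxy hyz ⟨u, hu⟩
      have hpt : ∀ {t s}, NonPerp t s → t ≤ u • π → s ≤ u • π →
          ∃ k : G2 K, k • π = π ∧ ∃ d ∈ ({1, g⁻¹} : Set (G2 K)), t = u • k • d • p := by
        intro t s hts ht hs
        have ht' : u⁻¹ • t ≤ π := by rwa [smul_le_iff, inv_inv]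
        have hs' : u⁻¹ • s ≤ π := by rwa [smul_le_iff, inv_inv]
        obtain ⟨x, hxl, hx⟩ := h.exists_nonPerp ht' hs' (hts.smul u⁻¹)
        obtain ⟨n, hn1, -, hn3⟩ := h.exists_smul_le hK hxl ht' hx
        obtain ⟨m, -, hm2, d, hd, he⟩ := h.exists_eq_smul hK hp hpl hg horb
          (isPoint_smul.2 hx.symm.isPoint) hn3
        refine ⟨n⁻¹ * m, ?_, d, hd, ?_⟩
        · rw [mul_smul, hm2, inv_smul_eq_iff, hn1]
        · rw [mul_smul, ← he, inv_smul_smul, smul_inv_smul]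
      simp only [Set.mem_insert_iff, Set.mem_singleton_iff, forall_eq_or_imp, forall_eq] at hu
      refine ⟨u, ?_⟩
      simp only [Set.mem_insert_iff, Set.mem_singleton_iff, forall_eq_or_imp, forall_eq]
      exact ⟨hpt hxy hu.1 hu.2.1, hpt hxy.symm hu.2.1 hu.1, hpt hyz.symm hu.2.2 hu.2.1⟩
    rcases h.exists_fill hK hxy hyz hxz with h1 | ⟨w, hwx, hwy, hwz, h1, h2, h3⟩
    · exact Or.inl (conv hxy hyz h1)
    · exact Or.inr ⟨w, hwx, hwy, hwz, conv hxy hwy.symm h1, conv hyz hwz.symm h2,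
        conv hxz hwz.symm h3⟩

end FlagGraph

/-! ### The universal enveloping group -/

namespace UniversalEnvelopingGroup

variable {J : Type v} [PartialOrder J] [Finite J] {n : ℕ} (A : Amalgam.{u, v} J n) (F : Fusion A)

theorem of_mul (j : J) (x y : A.grp j) : of A F j (x * y) = of A F j x * of A F j y :=
  (mul_inv_eq_one.1 (PresentedGroup.one_of_mem (rels := {w | FusedRel A F w})
    (FusedRel.mul j x y))).symm

theorem of_map {i j : J} (h : i < j) (x : A.grp i) : of A F j (A.map h x) = of A F i x :=
  (mul_inv_eq_one.1 (PresentedGroup.one_of_mem (rels := {w | FusedRel A F w})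
    (FusedRel.ident i j h x))).symm

theorem of_fuse (x : A.grp F.j₁) :
    of A F F.j₂ (F.γ x) = of A F F.j₀ F.g * of A F F.j₁ x * (of A F F.j₀ F.g)⁻¹ :=
  mul_inv_eq_one.1 (PresentedGroup.one_of_mem (rels := {w | FusedRel A F w}) (FusedRel.fuse x))

/-- The canonical homomorphism from a member of the amalgam. -/
def ofHom (j : J) : A.grp j →* UniversalEnvelopingGroup A F :=
  MonoidHom.mk' (of A F j) (of_mul A F j)

end UniversalEnvelopingGroup

section Parabolic

variable {G X : Type*} [Group G] [MulAction G X] {p l π₁ π₂ : X} {g : G}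
  (hg : g ∈ MulAction.stabilizer G l) (hπ : π₂ = g • π₁)

/-- The canonical homomorphism from the universal enveloping group of the fused amalgam of
parabolics to the group. -/
def envelopingHom :
    UniversalEnvelopingGroup (parabolicAmalgam G p l π₁ π₂) (parabolicFusion p l π₁ π₂ g hg hπ) →*
      G :=
  PresentedGroup.toGroup
    (f := fun x : Σ j, (parabolicAmalgam G p l π₁ π₂).grp j =>
      (parabolic (G := G) p l π₁ π₂ x.1).subtype x.2) (by
    rintro _ (⟨j, x, y⟩ | ⟨i, j, h, x⟩ | x)
    · simp only [map_mul, map_inv, FreeGroup.lift_apply_of]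
      exact mul_inv_cancel _
    · simp only [map_mul, map_inv, FreeGroup.lift_apply_of]
      exact mul_inv_cancel _
    · simp only [map_mul, map_inv, FreeGroup.lift_apply_of]
      exact mul_inv_cancel _)

theorem envelopingHom_of (j : ParabolicIndex) (x : parabolic (G := G) p l π₁ π₂ j) :
    envelopingHom hg hπ (UniversalEnvelopingGroup.of _ _ j x) = (x : G) := by
  unfold envelopingHom UniversalEnvelopingGroup.of
  exact PresentedGroup.toGroup.of _

/-- The generator of the universal enveloping group that stands for the element `x` of the
stabilisers at the node `j`. -/
abbrev parabolicOf (j : ParabolicIndex) (x : G) (hx : x ∈ parabolic (G := G) p l π₁ π₂ j) :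
    UniversalEnvelopingGroup (parabolicAmalgam G p l π₁ π₂)
      (parabolicFusion p l π₁ π₂ g hg hπ) :=
  UniversalEnvelopingGroup.of (parabolicAmalgam G p l π₁ π₂)
    (parabolicFusion p l π₁ π₂ g hg hπ) j ⟨x, hx⟩

theorem parabolicOf_eq_of_lt {i j : ParabolicIndex} (h : i < j) {x : G}
    (hx : x ∈ parabolic (G := G) p l π₁ π₂ i) :
    parabolicOf hg hπ j x (parabolic_mono p l π₁ π₂ h.le hx) = parabolicOf hg hπ i x hx :=
  UniversalEnvelopingGroup.of_map _ (parabolicFusion p l π₁ π₂ g hg hπ) h ⟨x, hx⟩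

theorem parabolicOf_mul_inv {x : G} (hx : x ∈ MulAction.stabilizer G π₁)
    (hx' : g * x * g⁻¹ ∈ MulAction.stabilizer G π₂) :
    parabolicOf (p := p) hg hπ .π₂ (g * x * g⁻¹) hx' =
      parabolicOf hg hπ .l g hg * parabolicOf hg hπ .π₁ x hx * (parabolicOf hg hπ .l g hg)⁻¹ :=
  UniversalEnvelopingGroup.of_fuse _ (parabolicFusion p l π₁ π₂ g hg hπ) ⟨x, hx⟩

theorem eq_top_of_parabolicOf_mem (H : Subgroup (UniversalEnvelopingGroup
      (parabolicAmalgam G p l π₁ π₂) (parabolicFusion p l π₁ π₂ g hg hπ)))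
    (hP : ∀ x hx, parabolicOf hg hπ .p x hx ∈ H) (hL : ∀ x hx, parabolicOf hg hπ .l x hx ∈ H)
    (hPi : ∀ x hx, parabolicOf hg hπ .π₁ x hx ∈ H) : H = ⊤ := by
  rw [← top_le_iff, ← PresentedGroup.closure_range_of, Subgroup.closure_le]
  rintro _ ⟨⟨j, x, hx⟩, rfl⟩
  change parabolicOf hg hπ j x hx ∈ H
  cases j
  case p => exact hP x hx
  case l => exact hL x hx
  case π₁ => exact hPi x hx
  case π₂ =>
    obtain ⟨⟨y, hy⟩, hyx⟩ := (MulAction.stabilizerEquivStabilizer hπ).surjective ⟨x, hx⟩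
    obtain rfl : g * y * g⁻¹ = x := congrArg Subtype.val hyx
    rw [parabolicOf_mul_inv hg hπ hy hx]
    exact mul_mem (mul_mem (hL g hg) (hPi y hy)) (inv_mem (hL g hg))
  case pl | pπ₁ | pπ₂ | plπ₁ | plπ₂ =>
    rw [← parabolicOf_eq_of_lt hg hπ (j := .p) (by decide)]
    exact hP x _
  case lπ₁ | lπ₂ =>
    rw [← parabolicOf_eq_of_lt hg hπ (j := .l) (by decide)]
    exact hL x _

/-- The universal enveloping group is generated by compatible copies of the stabilisers of `p`, `l`
and `π₁`. The fusion makes the stabiliser of `π₂` redundant, and what is left of it is that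
conjugation by `g` identifies the stabilisers of `g⁻¹ • p, π₁` and of `p, π₂`. -/
def parabolicStabilizerLift :
    StabilizerLift (envelopingHom (p := p) hg hπ) p l π₁ {1, g⁻¹} where
  liftP := UniversalEnvelopingGroup.ofHom (parabolicAmalgam G p l π₁ π₂)
    (parabolicFusion p l π₁ π₂ g hg hπ) .p
  liftL := UniversalEnvelopingGroup.ofHom (parabolicAmalgam G p l π₁ π₂)
    (parabolicFusion p l π₁ π₂ g hg hπ) .l
  liftPi := UniversalEnvelopingGroup.ofHom (parabolicAmalgam G p l π₁ π₂)
    (parabolicFusion p l π₁ π₂ g hg hπ) .π₁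
  map_liftP := envelopingHom_of hg hπ .p
  map_liftL := envelopingHom_of hg hπ .l
  map_liftPi := envelopingHom_of hg hπ .π₁
  liftP_eq_liftL x h h' :=
    (parabolicOf_eq_of_lt hg hπ (i := .pl) (j := .p) (by decide) ⟨h, h'⟩).trans
      (parabolicOf_eq_of_lt hg hπ (i := .pl) (j := .l) (by decide) ⟨h, h'⟩).symm
  liftL_eq_liftPi x h h' :=
    (parabolicOf_eq_of_lt hg hπ (i := .lπ₁) (j := .l) (by decide) ⟨h, h'⟩).trans
      (parabolicOf_eq_of_lt hg hπ (i := .lπ₁) (j := .π₁) (by decide) ⟨h, h'⟩).symm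
  mem_stabilizer := by
    rintro d (rfl | rfl)
    · exact one_mem _
    · exact inv_mem hg
  one_mem := by simp
  conj d hd x h h' hdD := by
    change (parabolicOf hg hπ .l d hd)⁻¹ * parabolicOf hg hπ .π₁ x h * parabolicOf hg hπ .l d hd =
      parabolicOf hg hπ .p (d⁻¹ * x * d) h'
    rcases hdD with rfl | rfl
    · have h1 : parabolicOf (p := p) hg hπ .l 1 hd = 1 :=
        map_one (UniversalEnvelopingGroup.ofHom (parabolicAmalgam G p l π₁ π₂)
          (parabolicFusion p l π₁ π₂ g hg hπ) .l)
      have h2 : 1⁻¹ * x * 1 = x := by simp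
      simp only [h2] at h' ⊢
      rw [h1, inv_one, one_mul, mul_one]
      exact (parabolicOf_eq_of_lt hg hπ (i := .pπ₁) (j := .π₁) (by decide) ⟨h', h⟩).trans
        (parabolicOf_eq_of_lt hg hπ (i := .pπ₁) (j := .p) (by decide) ⟨h', h⟩).symm
    · have h1 : parabolicOf (p := p) hg hπ .l g⁻¹ hd = (parabolicOf hg hπ .l g hg)⁻¹ :=
        map_inv (UniversalEnvelopingGroup.ofHom (parabolicAmalgam G p l π₁ π₂)
          (parabolicFusion p l π₁ π₂ g hg hπ) .l) ⟨g, hg⟩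
      have h4 : g * x * g⁻¹ ∈ MulAction.stabilizer G π₂ :=
        (MulAction.stabilizerEquivStabilizer hπ ⟨x, h⟩).2
      simp only [inv_inv] at h' ⊢
      rw [h1, inv_inv]
      exact (parabolicOf_mul_inv hg hπ h h4).symm.trans
        ((parabolicOf_eq_of_lt hg hπ (i := .pπ₂) (j := .π₂) (by decide) ⟨h', h4⟩).trans
          (parabolicOf_eq_of_lt hg hπ (i := .pπ₂) (j := .p) (by decide) ⟨h', h4⟩).symm)
  generate := eq_top_of_parabolicOf_mem hg hπ _
    (fun x hx => Subgroup.mem_sup_left (Subgroup.mem_sup_left ⟨⟨x, hx⟩, rfl⟩))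
    (fun x hx => Subgroup.mem_sup_left (Subgroup.mem_sup_right ⟨⟨x, hx⟩, rfl⟩))
    (fun x hx => Subgroup.mem_sup_right ⟨⟨x, hx⟩, rfl⟩)

end Parabolic

theorem theorem4 {K : Type*} [Field K] [CharP K 2]
    (hK : Function.Surjective (fun x : K => x ^ 2))
    (p l π₁ π₂ : Submodule K (V6 K)) (hchamber : IsChamber p l π₁)
    (g : G2 K) (hg : g ∈ MulAction.stabilizer (G2 K) l) (hπ : π₂ = g • π₁)
    (horbits : ∀ h ∈ MulAction.stabilizer (G2 K) p ⊓ MulAction.stabilizer (G2 K) l,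
      h • π₁ ≠ π₂) :
    ∃ e : UniversalEnvelopingGroup (parabolicAmalgam (G2 K) p l π₁ π₂)
        (parabolicFusion p l π₁ π₂ g hg hπ) ≃* G2 K,
      ∀ (j : ParabolicIndex) (x : parabolic (G := G2 K) p l π₁ π₂ j),
        e (UniversalEnvelopingGroup.of _ _ j x) = (x : G2 K) := by
  obtain ⟨⟨hp, hl, hs⟩, hpl, hle, -⟩ := hchamber
  have hflag := isStdFlag_of_isSpecialPlane hK hl hs hle
  have hgraph := hflag.isFlagGraph hK hl hp hpl hg
    fun h h1 h2 => by rw [← hπ]; exact horbits h ⟨h1, h2⟩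
  exact ⟨MulEquiv.ofBijective _ ((parabolicStabilizerLift hg hπ).bijective hgraph),
    envelopingHom_of hg hπ⟩
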